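/- Let $T_1,T_2,\dots$ be i.i.d. $\mathrm{Exp}(1)$ random variables and, for $1\le m\le n$, let $M_n^{(m)}$ be the $m$-th largest of $T_1,\dots,T_n$. Let $H_n=\sum_{j=1}^n 1/j$ (with $H_0=0$) and let $\gamma$ be Euler's constant. (i) For $1\le m\le n$ and every complex $s$ with $\operatorname{Re}s<m$, $e^{sM_n^{(m)}}$ is integrable and $$\mathbb E\, e^{sM_n^{(m)}}=\frac{\Gamma(n+1)\,\Gamma(m-s)}{\Gamma(m)\,\Gamma(n+1-s)};$$ moreover $M_n^{(m)}$ is integrable with $\mathbb E M_n^{(m)}=H_n-H_{m-1}$. (ii) As $n\to\infty$, $M_n^{(m)}-\log n$ converges in distribution, jointly for all $m\ge1$ (that is, in $\mathbb R^{\mathbb N}$ with the product topology, where $M_n^{(m)}$ is given the value $0$ for $m>n$), to a random sequence $(W^{(m)})_{m\ge1}$. In particular $M_n^{(m)}-\log n\to W^{(m)}$ in distribution for each $m$. For every such limit sequence $(W^{(m)})_{m\ge1}$ the following hold. (iii) For each $m\ge1$, $W^{(m)}\overset{d}{=}-\log\Gamma_m$, where $\Gamma_m$ has the Gamma distribution with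 shape $m$ and rate $1$; and for every complex $s$ with $\operatorname{Re}s<m$, $e^{sW^{(m)}}$ is integrable with $\mathbb E\,e^{sW^{(m)}}=\Gamma(m-s)/\Gamma(m)$. (iv) For each $m\ge1$, $W^{(m)}$ is integrable and $$\mathbb E W^{(m)}=\lim_{n\to\infty}\mathbb E\bigl(M_n^{(m)}-\log n\bigr)=\lim_{n\to\infty}\bigl(H_n-H_{m-1}-\log n\bigr)=\gamma-H_{m-1}.$$ (v) For each $m\ge1$ the series $\sum_{j=m}^\infty \frac1j(T_j-1)$ converges in $L^2$ and almost surely, and, jointly for all $m\ge1$, $$\sum_{j=m}^\infty\frac1j(T_j-1)\overset{d}{=}W^{(m)}-\mathbb E W^{(m)}= W^{(m)}-\gamma+H_{m-1}.$$ (vi) $W^{(1)}$ has the Gumbel distribution $\mathbb P(W^{(1)}\le x)=e^{-e^{-x}}$, $x\in\mathbb R$, and $W^{(1)},W^{(2)},\dots$ is a homogeneous Markov chain: for every $m\ge1$, the conditional distribution of $W^{(m+1)}$ given $W^{(1)},\dots,W^{(m)}$ is that of $(W\mid W\le W^{(m)})$, where $W$ is a Gumbel variable independent of $W^{(m)}$.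 Explicitly, for all $m\ge1$ and $x\le y$, $$\mathbb P\bigl(W^{(m+1)}\le x\mid W^{(m)}=y\bigr)=\exp\bigl(e^{-y}-e^{-x}\bigr).$$ (vii) As random sequences, $\bigl(e^{-W^{(1)}},e^{-W^{(2)}},\dots\bigr)\overset{d}{=}\bigl(T_1,\,T_1+T_2,\,T_1+T_2+T_3,\dots\bigr)$. -/

import Mathlib

open MeasureTheory ProbabilityTheory Filter Topology

/-- The `(k+1)`-st largest of the `n` real numbers `x 0, …, x (n-1)` (so `k = 0` is the maximum):
`Tuple.sort` lists the numbers in increasing order and `Fin.rev k` is position `n - 1 - k`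
of that list. If `k ≥ n` there is no such number, and the value is `0`. -/
noncomputable def kthLargest (n k : ℕ) (x : ℕ → ℝ) : ℝ :=
  if h : k < n then
    x ((Tuple.sort (fun i : Fin n => x i) (Fin.rev ⟨k, h⟩) : Fin n) : ℕ)
  else 0

/-- `X 0, X 1, …` is a time-homogeneous Markov chain with transition kernel `κ`: for every `k`,
the conditional distribution of `X (k+1)` given the whole history `(X 0, …, X k)`
is `κ (X k)`. -/
def IsHomogeneousMarkovChain {Ω S : Type*} [MeasurableSpace Ω] [MeasurableSpace S]
    (X : ℕ → Ω → S) (κ : Kernel S S) (P : Measure Ω) : Prop :=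
  IsMarkovKernel κ ∧ ∀ k : ℕ,
    HasCondDistrib (X (k + 1)) (fun ω => fun i : Fin (k + 1) => X i ω)
      (κ.comap (fun h : Fin (k + 1) → S => h (Fin.last k)) (measurable_pi_apply _)) P

/-! Two distributional identities put the whole limit theorem on one probability space, where it
becomes almost sure convergence.

Rényi's representation (`map_kthLargest_expSeq`): jointly in `k`, the order statistics of `n`
independent Exp(1) variables have the law of `∑_{k ≤ j < n} x_j/(j+1)`. Means, variances and moment
generating functions of these sums of independent terms are explicit, which gives (i).

Invariance of the exponential sequence (`map_logIncr_expSeq`): with `S_j = x_0 + … + x_j`, the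
variables `(j+1)(log S_{j+1} - log S_j)` are again independent Exp(1). This iterates the gamma
identity `map_gammaMeasure_prod_expMeasure`. Inserted into Rényi's sums they telescope to `log S_n -
log S_k`, and by the strong law `log S_n - log n → 0`. Hence the recentred order statistics have the
law of variables converging almost surely to `-log S_k`, simultaneously for all `k`.

The limit is thus the sequence `-log S_k`, unique in law. Gamma marginals and (vii) are immediate;
the Markov property comes from `S_{k+1} = S_k + x_{k+1}` with a fresh exponential step. Since `H_N -
log N → γ`, the same telescoping shows that the centred series converge almost surely and identifies
their joint law; variance bounds give `L²` convergence, so the series have mean zero, and this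
yields `E W`. -/

/-! ### The gamma identity for `X + T` and `log (X + T) - log X`. -/

open scoped ENNReal in
/-- Lebesgue integrals against the Gamma distribution of rate `1`. -/
lemma lintegral_gammaMeasure_one {a : ℝ} {F : ℝ → ℝ≥0∞} (hF : Measurable F) :
    ∫⁻ x, F x ∂gammaMeasure a 1 =
      ∫⁻ x in Set.Ioi 0, ENNReal.ofReal (x ^ (a - 1) * Real.exp (-x) / Real.Gamma a) * F x := by
  have hm : Measurable (gammaPDF a 1) := (measurable_gammaPDFReal a 1).ennreal_ofReal
  rw [gammaMeasure, lintegral_withDensity_eq_lintegral_mul _ hm hF,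
    ← lintegral_add_compl _ (measurableSet_Ioi (a := (0 : ℝ)))]
  have h0 : ∫⁻ x in (Set.Ioi (0 : ℝ))ᶜ, (gammaPDF a 1 * F) x = 0 := by
    rw [Set.compl_Ioi, setLIntegral_congr (Iio_ae_eq_Iic (a := (0 : ℝ))).symm]
    refine setLIntegral_eq_zero measurableSet_Iio fun x hx => ?_
    simp [gammaPDF_of_neg (Set.mem_Iio.1 hx)]
  rw [h0, add_zero]
  refine setLIntegral_congr_fun measurableSet_Ioi fun x hx => ?_
  simp only [Pi.mul_apply]
  rw [gammaPDF_of_nonneg (Set.mem_Ioi.1 hx).le]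
  congr 2
  simp
  ring

open scoped ENNReal in
lemma lintegral_expMeasure_one {F : ℝ → ℝ≥0∞} (hF : Measurable F) :
    ∫⁻ x, F x ∂expMeasure 1 = ∫⁻ x in Set.Ioi 0, ENNReal.ofReal (Real.exp (-x)) * F x := by
  rw [expMeasure, lintegral_gammaMeasure_one hF]
  simp

-- Substitution `x = s * exp (-u / a)`. It is the inner integral of the gamma identity: with the sum
-- `s` fixed, the rescaled log ratio is exponential, whatever `s` is.
open scoped ENNReal in
lemma lintegral_Ioo_log_sub_log {a s : ℝ} (ha : 0 < a) (hs : 0 < s) (F : ℝ → ℝ≥0∞) :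
    ∫⁻ x in Set.Ioo 0 s, ENNReal.ofReal (x ^ (a - 1)) * F (a * (Real.log s - Real.log x)) =
      ENNReal.ofReal (s ^ a / a) *
        ∫⁻ u in Set.Ioi 0, ENNReal.ofReal (Real.exp (-u)) * F u := by
  have himg : (fun u => s * Real.exp (-u / a)) '' Set.Ioi 0 = Set.Ioo 0 s := by
    ext x
    constructor
    · rintro ⟨u, hu, rfl⟩
      have hu : 0 < u := hu
      refine ⟨by positivity, ?_⟩
      have : Real.exp (-u / a) < 1 := by
        rw [Real.exp_lt_one_iff]
        exact div_neg_of_neg_of_pos (by linarith) ha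
      simpa using mul_lt_mul_of_pos_left this hs
    · rintro ⟨h0, h1⟩
      refine ⟨a * (Real.log s - Real.log x), ?_, ?_⟩
      · exact mul_pos ha (sub_pos.2 (Real.log_lt_log h0 h1))
      · have : -(a * (Real.log s - Real.log x)) / a = Real.log x - Real.log s := by
          field_simp; ring
        simp only [this, Real.exp_sub, Real.exp_log h0, Real.exp_log hs]
        field_simp
  have hinj : Set.InjOn (fun u => s * Real.exp (-u / a)) (Set.Ioi 0) := by
    intro u _ v _ h
    have := Real.exp_injective (mul_left_cancel₀ hs.ne' h)
    field_simp at this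
    linarith
  have hder : ∀ u ∈ Set.Ioi (0 : ℝ), HasDerivWithinAt (fun u => s * Real.exp (-u / a))
      (-(s / a * Real.exp (-u / a))) (Set.Ioi 0) u := by
    intro u _
    have h := ((((hasDerivAt_id u).neg).div_const a).exp.const_mul s).hasDerivWithinAt
      (s := Set.Ioi 0)
    refine h.congr_deriv ?_
    simp only [id, Pi.neg_apply]
    ring
  rw [← himg, lintegral_image_eq_lintegral_abs_deriv_mul measurableSet_Ioi hder hinj,
    ← lintegral_const_mul' _ _ ENNReal.ofReal_ne_top]
  refine setLIntegral_congr_fun measurableSet_Ioi fun u hu => ?_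
  have e1 : a * (Real.log s - Real.log (s * Real.exp (-u / a))) = u := by
    rw [Real.log_mul hs.ne' (Real.exp_ne_zero _), Real.log_exp]
    field_simp
    ring
  simp only [e1]
  rw [← mul_assoc, ← mul_assoc, ← ENNReal.ofReal_mul (by positivity),
    ← ENNReal.ofReal_mul (by positivity)]
  congr 2
  rw [abs_neg, abs_of_pos (by positivity), Real.mul_rpow hs.le (Real.exp_pos _).le,
    ← Real.exp_mul]
  have e2 : s ^ a = s ^ (a - 1) * s := by
    rw [← Real.rpow_add_one hs.ne']; ring_nf
  have e3 : Real.exp (-u) = Real.exp (-u / a * (a - 1)) * Real.exp (-u / a) := by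
    rw [← Real.exp_add]; congr 1; field_simp; ring
  rw [e2, e3]
  ring

/-- If `X` is `Gamma(a)` and `T` is an independent `Exp(1)` variable, then
`a (log (X + T) - log X)` and `X + T` are independent, with laws `Exp(1)` and `Gamma(a + 1)`. -/
lemma map_gammaMeasure_prod_expMeasure {a : ℝ} (ha : 0 < a) :
    ((gammaMeasure a 1).prod (expMeasure 1)).map
        (fun p => (a * (Real.log (p.1 + p.2) - Real.log p.1), p.1 + p.2)) =
      (expMeasure 1).prod (gammaMeasure (a + 1) 1) := by
  have := isProbabilityMeasure_gammaMeasure ha one_pos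
  have := isProbabilityMeasure_gammaMeasure (a := a + 1) (by linarith) one_pos
  have := isProbabilityMeasure_expMeasure one_pos
  refine Measure.ext_of_lintegral _ fun F hF => ?_
  have hφ : Measurable fun p : ℝ × ℝ =>
      (a * (Real.log (p.1 + p.2) - Real.log p.1), p.1 + p.2) := by fun_prop
  have hFφ : Measurable fun p : ℝ × ℝ =>
      F (a * (Real.log (p.1 + p.2) - Real.log p.1), p.1 + p.2) := hF.comp hφ
  rw [lintegral_map hF hφ, lintegral_prod _ hFφ.aemeasurable,
    lintegral_gammaMeasure_one hFφ.lintegral_prod_right',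
    lintegral_prod_symm _ hF.aemeasurable,
    lintegral_gammaMeasure_one hF.lintegral_prod_left']
  -- The integrand after the shear `s = x + t`, supported on `0 < x < s`. Swapping the order of
  -- integration then leaves `s` as the outer variable.
  set w : ℝ → ℝ → ENNReal := fun x s =>
    Set.indicator {p : ℝ × ℝ | 0 < p.1 ∧ p.1 < p.2}
      (fun p => ENNReal.ofReal (p.1 ^ (a - 1) * Real.exp (-p.2) / Real.Gamma a) *
        F (a * (Real.log p.2 - Real.log p.1), p.2)) (x, s) with hw
  have hwm : Measurable (Function.uncurry w) := by
    refine Measurable.indicator ?_ ?_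
    · refine Measurable.mul ?_ ?_
      · fun_prop
      · exact hF.comp (by fun_prop)
    · exact (measurableSet_lt measurable_const measurable_fst).inter
        (measurableSet_lt measurable_fst measurable_snd)
  have hL : ∫⁻ x in Set.Ioi 0, ENNReal.ofReal (x ^ (a - 1) * Real.exp (-x) / Real.Gamma a) *
      ∫⁻ t, F (a * (Real.log (x + t) - Real.log x), x + t) ∂expMeasure 1 =
      ∫⁻ x, ∫⁻ s, w x s := by
    rw [← lintegral_indicator measurableSet_Ioi]
    refine lintegral_congr fun x => ?_
    by_cases hx : 0 < x
    · have hx' : x ∈ Set.Ioi (0 : ℝ) := hx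
      rw [Set.indicator_of_mem hx', lintegral_expMeasure_one
        (F := fun t => F (a * (Real.log (x + t) - Real.log x), x + t))
        (hFφ.comp (measurable_prodMk_left (x := x))), ← lintegral_indicator measurableSet_Ioi,
        ← lintegral_const_mul' _ _ ENNReal.ofReal_ne_top,
        ← lintegral_add_left_eq_self (fun s => w x s) x]
      refine lintegral_congr fun t => ?_
      by_cases ht : 0 < t
      · have ht' : t ∈ Set.Ioi (0 : ℝ) := ht
        rw [Set.indicator_of_mem ht', hw]
        simp only
        rw [Set.indicator_of_mem (by simp [hx, ht]), ← mul_assoc,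
          ← ENNReal.ofReal_mul' (Real.exp_pos _).le]
        congr 2
        rw [neg_add, Real.exp_add]
        ring
      · have ht' : t ∉ Set.Ioi (0 : ℝ) := ht
        rw [Set.indicator_of_notMem ht', hw]
        simp only
        rw [Set.indicator_of_notMem (by simp [hx]; linarith), mul_zero]
    · have hx' : x ∉ Set.Ioi (0 : ℝ) := hx
      rw [Set.indicator_of_notMem hx']
      symm
      refine (lintegral_congr fun s => ?_).trans lintegral_zero
      rw [hw]
      simp [hx]
  rw [hL, lintegral_lintegral_swap hwm.aemeasurable, ← lintegral_indicator measurableSet_Ioi]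
  refine lintegral_congr fun s => ?_
  by_cases hs : 0 < s
  · have hs' : s ∈ Set.Ioi (0 : ℝ) := hs
    rw [Set.indicator_of_mem hs', lintegral_expMeasure_one (F := fun u => F (u, s))
      (hF.comp measurable_prodMk_right)]
    have h1 : ∫⁻ x, w x s = ENNReal.ofReal (Real.exp (-s) / Real.Gamma a) *
        ∫⁻ x in Set.Ioo 0 s, ENNReal.ofReal (x ^ (a - 1)) *
          F (a * (Real.log s - Real.log x), s) := by
      rw [← lintegral_const_mul' _ _ ENNReal.ofReal_ne_top,
        ← lintegral_indicator measurableSet_Ioo]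
      refine lintegral_congr fun x => ?_
      by_cases hx : x ∈ Set.Ioo 0 s
      · rw [Set.indicator_of_mem hx, hw]
        simp only
        rw [Set.indicator_of_mem (by simpa using hx), ← mul_assoc,
          ← ENNReal.ofReal_mul (div_nonneg (Real.exp_pos _).le (Real.Gamma_pos_of_pos ha).le)]
        congr 2
        ring
      · rw [Set.indicator_of_notMem hx, hw]
        simp only
        rw [Set.indicator_of_notMem (by simpa using hx)]
    rw [h1, lintegral_Ioo_log_sub_log ha hs (fun u => F (u, s)), ← mul_assoc,
      ← ENNReal.ofReal_mul (div_nonneg (Real.exp_pos _).le (Real.Gamma_pos_of_pos ha).le)]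
    congr 2
    -- The factor `s ^ a / a` from the substitution becomes the Gamma(a + 1) density because `Γ(a +
    -- 1) = a Γ(a)`.
    rw [Real.Gamma_add_one ha.ne', add_sub_cancel_right]
    field_simp
  · have hs' : s ∉ Set.Ioi (0 : ℝ) := hs
    rw [Set.indicator_of_notMem hs']
    refine (lintegral_congr fun x => ?_).trans lintegral_zero
    rw [hw]
    simp only
    rw [Set.indicator_of_notMem (by simp; intro h; linarith)]

/-! ### The exponential sequence and its invariance under `logIncr`. -/

instance isProbabilityMeasure_expMeasure_one : IsProbabilityMeasure (expMeasure 1) :=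
  isProbabilityMeasure_expMeasure one_pos

/-- The law of a sequence of independent `Exp(1)` variables. -/
noncomputable def expSeq : Measure (ℕ → ℝ) := Measure.infinitePi fun _ => expMeasure 1

instance : IsProbabilityMeasure expSeq := by unfold expSeq; infer_instance

lemma hasLaw_eval_expSeq (i : ℕ) : HasLaw (fun x : ℕ → ℝ => x i) (expMeasure 1) expSeq :=
  (measurePreserving_eval_infinitePi (fun _ : ℕ => expMeasure 1) i).hasLaw

lemma iIndepFun_eval_expSeq : iIndepFun (fun (i : ℕ) (x : ℕ → ℝ) => x i) expSeq :=
  iIndepFun_infinitePi (P := fun _ : ℕ => expMeasure 1) (X := fun _ x => x)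
    fun _ => measurable_id

/-- A function of the first `n` coordinates is independent of the next one. -/
lemma indepFun_eval_expSeq {β : Type*} [MeasurableSpace β] {f : (ℕ → ℝ) → β} (hf : Measurable f)
    {n : ℕ} (hdep : ∀ x, f (fun i => if i < n then x i else 0) = f x) :
    IndepFun f (fun x => x n) expSeq := by
  have h := iIndepFun_eval_expSeq.indepFun_finset (Finset.range n) {n} (by simp)
    (fun i => measurable_pi_apply i)
  -- Extension by zero makes `f` a function of the first `n` coordinates alone; `hdep` says that
  -- this loses nothing.
  have hext : Measurable fun (y : Finset.range n → ℝ) (i : ℕ) =>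
      if h : i ∈ Finset.range n then y ⟨i, h⟩ else 0 := by
    refine measurable_pi_lambda _ fun i => ?_
    by_cases hi : i ∈ Finset.range n
    · simpa [hi] using measurable_pi_apply _
    · simp [hi]
  have h2 := h.comp (hf.comp hext) (measurable_pi_apply (⟨n, by simp⟩ : ({n} : Finset ℕ)))
  have e : (f ∘ fun (y : Finset.range n → ℝ) (i : ℕ) =>
      if h : i ∈ Finset.range n then y ⟨i, h⟩ else 0) ∘
      (fun (x : ℕ → ℝ) (i : Finset.range n) => x i) = f := by
    funext x
    rw [← hdep x]
    simp [Function.comp_def]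
  rw [← e]
  exact h2

lemma ae_pos_expMeasure : ∀ᵐ t ∂expMeasure 1, 0 < t := by
  have h := lintegral_expMeasure_one (F := Set.indicator (Set.Iic 0) 1)
    (measurable_one.indicator measurableSet_Iic)
  rw [lintegral_indicator_one measurableSet_Iic] at h
  rw [ae_iff]
  simp only [not_lt]
  refine h.trans (setLIntegral_eq_zero measurableSet_Ioi fun t ht => ?_)
  rw [Set.indicator_of_notMem (by simpa using ht), mul_zero]
  rfl

lemma ae_pos_expSeq : ∀ᵐ x ∂expSeq, ∀ i, 0 < x i := by
  rw [ae_all_iff]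
  intro i
  refine ((hasLaw_eval_expSeq i).ae_iff (p := fun t => 0 < t) ?_).2 ae_pos_expMeasure
  exact measurableSet_setOfPred.1 measurableSet_Ioi

/-- The rescaled logarithmic increments of the partial sums `x 0 + … + x n`. -/
noncomputable def logIncr (x : ℕ → ℝ) (j : ℕ) : ℝ :=
  (j + 1) * (Real.log (∑ i ∈ Finset.range (j + 2), x i) -
    Real.log (∑ i ∈ Finset.range (j + 1), x i))

lemma measurable_logIncr : Measurable logIncr := by
  unfold logIncr
  fun_prop

/-- Carrying the partial sum along makes the induction close: the next increment and the next sum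
are functions of the current sum and a fresh coordinate, and the gamma identity makes them
independent of each other and of the earlier increments. -/
lemma expSeq_logIncr_inter_sum (t : ℕ → Set ℝ) (ht : ∀ i, MeasurableSet (t i)) (n : ℕ)
    (B : Set ℝ) (hB : MeasurableSet B) :
    expSeq {x | (∀ i < n, logIncr x i ∈ t i) ∧ ∑ i ∈ Finset.range (n + 1), x i ∈ B} =
      (∏ i ∈ Finset.range n, expMeasure 1 (t i)) * gammaMeasure (n + 1) 1 B := by
  induction n generalizing B with
  | zero =>
    have := (hasLaw_eval_expSeq 0).measure_eq (p := fun y => y ∈ B) hB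
    simpa [expMeasure] using this
  | succ n ih =>
    have hlm : ∀ i, Measurable fun x => logIncr x i := fun i =>
      (measurable_pi_apply i).comp measurable_logIncr
    set A : Set (ℕ → ℝ) := {x | ∀ i < n, logIncr x i ∈ t i} with hA
    have hAm : MeasurableSet A := by
      simp only [hA, Set.ofPred_forall]
      exact .iInter fun i => .iInter fun _ => hlm i (ht i)
    have hγ : IsProbabilityMeasure (gammaMeasure (n + 1) 1) :=
      isProbabilityMeasure_gammaMeasure (by positivity) one_pos
    have hγ' : IsProbabilityMeasure (gammaMeasure ((n : ℝ) + 1 + 1) 1) :=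
      isProbabilityMeasure_gammaMeasure (by positivity) one_pos
    set c := ∏ i ∈ Finset.range n, expMeasure 1 (t i) with hc
    have hpair : Measurable fun x : ℕ → ℝ => (∑ i ∈ Finset.range (n + 1), x i, x (n + 1)) := by
      fun_prop
    -- On the event `A` fixing the earlier increments, the current sum and the next coordinate are
    -- still independent, with total mass `c`.
    have hlaw : (expSeq.restrict A).map
        (fun x => (∑ i ∈ Finset.range (n + 1), x i, x (n + 1))) =
        (c • gammaMeasure (n + 1) 1).prod (expMeasure 1) := by
      have : SigmaFinite (c • gammaMeasure (n + 1) 1) := by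
        have hc' : c ≠ ⊤ := ENNReal.prod_ne_top fun i _ => measure_ne_top _ _
        have : IsFiniteMeasure (c • gammaMeasure (n + 1) 1) := Measure.smul_finite _ hc'
        infer_instance
      refine (Measure.prod_eq fun s u hs hu => ?_).symm
      rw [Measure.map_apply hpair (hs.prod hu), Measure.restrict_apply (hpair (hs.prod hu))]
      -- The event enters as a `Prop`-valued coordinate, so that one independence statement covers
      -- both the event and the sum.
      have hf : Measurable fun x : ℕ → ℝ => (x ∈ A, ∑ i ∈ Finset.range (n + 1), x i) := by
        refine Measurable.prodMk ?_ (by fun_prop)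
        exact measurableSet_setOfPred.1 hAm
      have hind := indepFun_eval_expSeq (n := n + 1) hf (by
        intro x
        have hs : ∀ k ≤ n, ∑ i ∈ Finset.range (k + 1), (if i < n + 1 then x i else 0) =
            ∑ i ∈ Finset.range (k + 1), x i := fun k hk =>
          Finset.sum_congr rfl fun i hi => if_pos (by simp at hi; omega)
        have hl : ∀ i < n, logIncr (fun i => if i < n + 1 then x i else 0) i = logIncr x i := by
          intro i hi
          simp only [logIncr]
          rw [hs i hi.le, hs (i + 1) hi]
        simp only [Prod.mk.injEq, hs n le_rfl, and_true, hA, Set.mem_ofPred_eq]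
        exact propext (forall₂_congr fun i hi => by rw [hl i hi]))
      have h := hind.measure_inter_preimage_eq_mul ({True} ×ˢ s) u
        ((measurableSet_singleton _).prod hs) hu
      have h1 := (hasLaw_eval_expSeq (n + 1)).measure_eq (p := fun y => y ∈ u) hu
      have e1 : (fun x : ℕ → ℝ => (x ∈ A, ∑ i ∈ Finset.range (n + 1), x i)) ⁻¹'
          ({True} ×ˢ s) = {x | (∀ i < n, logIncr x i ∈ t i) ∧
            ∑ i ∈ Finset.range (n + 1), x i ∈ s} := by
        ext x; simp [hA]
      rw [e1, ih s hs] at h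
      rw [Measure.smul_apply, smul_eq_mul]
      change expSeq ((fun x => x (n + 1)) ⁻¹' u) = expMeasure 1 u at h1
      rw [← h1]
      refine Eq.trans (congrArg _ ?_) h
      ext x
      simp [hA]
      tauto
    have hφ : Measurable fun p : ℝ × ℝ =>
        (((n : ℝ) + 1) * (Real.log (p.1 + p.2) - Real.log p.1), p.1 + p.2) := by fun_prop
    have key := congrArg (fun m => (m.map fun p : ℝ × ℝ =>
        (((n : ℝ) + 1) * (Real.log (p.1 + p.2) - Real.log p.1), p.1 + p.2)) (t n ×ˢ B)) hlaw
    rw [Measure.prod_smul_left, Measure.map_smul,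
      map_gammaMeasure_prod_expMeasure (a := (n : ℝ) + 1) (by positivity),
      Measure.map_map hφ hpair, Measure.map_apply (hφ.comp hpair) ((ht n).prod hB),
      Measure.restrict_apply ((hφ.comp hpair) ((ht n).prod hB)), Measure.smul_apply,
      Measure.prod_prod, smul_eq_mul, ← mul_assoc] at key
    rw [Finset.prod_range_succ, ← hc]
    push_cast
    rw [← key]
    congr 1
    ext x
    simp only [Set.mem_ofPred_eq, Set.mem_inter_iff, Set.mem_preimage, Function.comp_apply,
      Set.mem_prod, ← Finset.sum_range_succ, hA]
    rw [Nat.forall_lt_succ_right]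
    simp only [logIncr]
    tauto

/-- A product measure is determined by finite cylinders, and these are the previous formula with no
constraint on the sum; indices outside `s` are filled with `Set.univ`. -/
lemma map_logIncr_expSeq : expSeq.map logIncr = expSeq := by
  refine Measure.eq_infinitePi _ fun s t ht => ?_
  rw [Measure.map_apply measurable_logIncr (MeasurableSet.pi s.countable_toSet fun i _ => ht i)]
  obtain ⟨n, hn⟩ := s.exists_nat_subset_range
  have h := expSeq_logIncr_inter_sum (fun i => if i ∈ s then t i else Set.univ)
    (fun i => by split_ifs; exacts [ht i, .univ]) n Set.univ .univ
  have hγ : IsProbabilityMeasure (gammaMeasure (n + 1) 1) :=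
    isProbabilityMeasure_gammaMeasure (by positivity) one_pos
  rw [measure_univ, mul_one] at h
  have e : ∏ i ∈ s, expMeasure 1 (t i) =
      ∏ i ∈ Finset.range n, expMeasure 1 (if i ∈ s then t i else Set.univ) := by
    rw [← Finset.prod_subset hn]
    · exact Finset.prod_congr rfl fun i hi => by rw [if_pos hi]
    · intro i _ hi
      rw [if_neg hi, measure_univ]
  rw [e, ← h]
  congr 1
  ext x
  simp only [Set.mem_preimage, Set.mem_pi, Finset.mem_coe, Set.mem_univ, and_true,
    Set.mem_ofPred_eq]
  constructor
  · intro hx i _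
    split_ifs with hi
    exacts [hx i hi, trivial]
  · intro hx i hi
    simpa [hi] using hx i (by simpa using hn hi)

lemma hasLaw_sum_expSeq (n : ℕ) :
    HasLaw (fun x : ℕ → ℝ => ∑ i ∈ Finset.range (n + 1), x i) (gammaMeasure (n + 1) 1) expSeq := by
  refine ⟨by fun_prop, Measure.ext fun B hB => ?_⟩
  have h := expSeq_logIncr_inter_sum (fun _ => Set.univ) (fun _ => .univ) n B hB
  rw [Measure.map_apply (by fun_prop) hB]
  simpa [Set.preimage] using h

/-! ### Rényi's representation of the order statistics. -/

lemma integrable_exponentialPDFReal_one : Integrable (exponentialPDFReal 1) := by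
  refine ⟨(measurable_exponentialPDFReal 1).aestronglyMeasurable, ?_⟩
  have h := lintegral_exponentialPDF_eq_one (r := 1) one_pos
  rw [hasFiniteIntegral_iff_ofReal (Eventually.of_forall (exponentialPDFReal_nonneg one_pos))]
  exact h.trans_lt ENNReal.one_lt_top

lemma expMeasure_eq_withDensity :
    expMeasure 1 = volume.withDensity (fun t => ENNReal.ofReal (exponentialPDFReal 1 t)) := rfl

/-- The joint density of independent `Exp(1)` variables. -/
noncomputable def expDensity {n : ℕ} (x : Fin n → ℝ) : ENNReal :=
  ENNReal.ofReal (∏ i, exponentialPDFReal 1 (x i))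

lemma measurable_expDensity {n : ℕ} : Measurable (expDensity (n := n)) := by
  unfold expDensity
  refine (Finset.measurable_prod _ fun i _ => ?_).ennreal_ofReal
  exact (measurable_exponentialPDFReal 1).comp (measurable_pi_apply i)

lemma pi_expMeasure_eq_withDensity (n : ℕ) :
    Measure.pi (fun _ : Fin n => expMeasure 1) = volume.withDensity expDensity := by
  refine Measure.pi_eq fun s hs => ?_
  have hnn := exponentialPDFReal_nonneg (r := 1) one_pos
  rw [withDensity_apply _ (MeasurableSet.univ_pi hs), volume_pi, Measure.restrict_pi_pi]
  unfold expDensity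
  rw [← ofReal_integral_eq_lintegral_ofReal
      (Integrable.fintype_prod fun i => integrable_exponentialPDFReal_one.restrict)
      (Eventually.of_forall fun x => Finset.prod_nonneg fun i _ => hnn _),
    integral_fintype_prod_eq_prod (fun _ => exponentialPDFReal 1),
    ENNReal.ofReal_prod_of_nonneg fun i _ => integral_nonneg hnn]
  refine Finset.prod_congr rfl fun i _ => ?_
  rw [ofReal_integral_eq_lintegral_ofReal integrable_exponentialPDFReal_one.restrict
    (Eventually.of_forall hnn), expMeasure_eq_withDensity, withDensity_apply _ (hs i)]

lemma map_comp_perm_pi {n : ℕ} (ν : Measure ℝ) [SigmaFinite ν] (σ : Equiv.Perm (Fin n)) :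
    (Measure.pi (fun _ : Fin n => ν)).map (fun x => x ∘ σ) = Measure.pi (fun _ : Fin n => ν) := by
  refine (Measure.pi_eq fun s hs => ?_).symm
  rw [Measure.map_apply (by fun_prop) (MeasurableSet.univ_pi hs)]
  have : (fun x : Fin n → ℝ => x ∘ σ) ⁻¹' Set.univ.pi s = Set.univ.pi (fun i => s (σ.symm i)) := by
    ext x
    simp only [Set.mem_preimage, Set.mem_univ_pi, Function.comp_apply]
    exact ⟨fun h i => by simpa using h (σ.symm i), fun h i => by simpa using h (σ i)⟩
  rw [this, Measure.pi_pi]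
  exact Equiv.prod_comp σ.symm fun i => ν (s i)

/-- Ties lie in finitely many hyperplanes `x i = x j`, which are Lebesgue null. -/
lemma ae_injective_pi_expMeasure (n : ℕ) :
    ∀ᵐ x ∂Measure.pi (fun _ : Fin n => expMeasure 1), Function.Injective x := by
  rw [pi_expMeasure_eq_withDensity]
  refine (withDensity_absolutelyContinuous _ _).ae_le ?_
  have h : ∀ i j : Fin n, i ≠ j → ∀ᵐ x : Fin n → ℝ, x i ≠ x j := by
    intro i j hij
    have := Measure.addHaar_submodule (volume : Measure (Fin n → ℝ))
      (LinearMap.ker (LinearMap.proj (R := ℝ) (φ := fun _ : Fin n => ℝ) i - LinearMap.proj j)) (by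
        intro htop
        have h1 : (Pi.single i 1 : Fin n → ℝ) ∈ LinearMap.ker
            (LinearMap.proj (R := ℝ) (φ := fun _ : Fin n => ℝ) i - LinearMap.proj j) := by
          rw [htop]; trivial
        simp [LinearMap.mem_ker, hij.symm] at h1)
    rw [ae_iff]
    convert this using 2
    ext x
    simp [sub_eq_zero]
  have h' : ∀ᵐ x : Fin n → ℝ, ∀ i j : Fin n, i ≠ j → x i ≠ x j := by
    rw [ae_all_iff]; intro i
    rw [ae_all_iff]; intro j
    by_cases hij : i = j
    · simp [hij]
    · simpa [hij] using h i j hij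
  filter_upwards [h'] with x hx i j hij
  by_contra hne
  exact hx i j hne hij

/-- The decreasing rearrangement of a tuple of real numbers. -/
noncomputable def decreasing {n : ℕ} (x : Fin n → ℝ) (k : Fin n) : ℝ := x (Tuple.sort x (Fin.rev k))

lemma measurableSet_sort_eq {n : ℕ} (σ : Equiv.Perm (Fin n)) :
    MeasurableSet {x : Fin n → ℝ | Tuple.sort x = σ} := by
  have : {x : Fin n → ℝ | Tuple.sort x = σ} = {x | (∀ i j, i ≤ j → x (σ i) ≤ x (σ j)) ∧
      ∀ i j, i < j → x (σ i) = x (σ j) → σ i < σ j} := by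
    ext x
    simp only [Set.mem_ofPred_eq]
    rw [eq_comm, Tuple.eq_sort_iff]
    rfl
  rw [this]
  simp only [Set.ofPred_and, Set.ofPred_forall]
  refine .inter ?_ ?_
  · exact .iInter fun i => .iInter fun j => .iInter fun _ =>
      measurableSet_le (measurable_pi_apply _) (measurable_pi_apply _)
  · refine .iInter fun i => .iInter fun j => .iInter fun _ => ?_
    by_cases h : σ i < σ j
    · simp [h]
    · simp only [h, imp_false]
      exact (measurableSet_eq_fun (f := fun x : Fin n → ℝ => x _) (measurable_pi_apply _)
        (measurable_pi_apply _)).compl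

lemma measurable_decreasing {n : ℕ} : Measurable (decreasing (n := n)) := by
  refine measurable_pi_lambda _ fun k B hB => ?_
  have : (fun x : Fin n → ℝ => decreasing x k) ⁻¹' B =
      ⋃ σ : Equiv.Perm (Fin n), {x | Tuple.sort x = σ} ∩ (fun x => x (σ (Fin.rev k))) ⁻¹' B := by
    ext x
    simp [decreasing]
  rw [this]
  exact .iUnion fun σ => (measurableSet_sort_eq σ).inter (measurable_pi_apply _ hB)

lemma measurableSet_strictAnti {n : ℕ} : MeasurableSet {x : Fin n → ℝ | StrictAnti x} := by
  have : {x : Fin n → ℝ | StrictAnti x} = {x | ∀ i j, i < j → x j < x i} := rfl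
  rw [this]
  simp only [Set.ofPred_forall]
  exact .iInter fun i => .iInter fun j => .iInter fun _ =>
    measurableSet_lt (measurable_pi_apply _) (measurable_pi_apply _)

lemma antitone_decreasing {n : ℕ} (x : Fin n → ℝ) : Antitone (decreasing x) := fun _ _ h =>
  Tuple.monotone_sort x (Fin.rev_le_rev.2 h)

lemma decreasing_eq_of_antitone {n : ℕ} {x : Fin n → ℝ} {σ : Equiv.Perm (Fin n)}
    (h : Antitone (x ∘ σ)) : decreasing x = x ∘ σ :=
  Tuple.unique_antitone (σ := Fin.revPerm.trans (Tuple.sort x)) (antitone_decreasing x) h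

/-- The decreasing rearrangement of independent `Exp(1)` variables has the law of these variables
restricted to the decreasing tuples, up to a constant factor. -/
lemma map_decreasing_pi (n : ℕ) :
    (Measure.pi (fun _ : Fin n => expMeasure 1)).map decreasing =
      (n.factorial : ENNReal) •
        (Measure.pi (fun _ : Fin n => expMeasure 1)).restrict {x | StrictAnti x} := by
  ext A hA
  set μ := Measure.pi (fun _ : Fin n => expMeasure 1) with hμ
  have hcm : ∀ σ : Equiv.Perm (Fin n), Measurable fun x : Fin n → ℝ => x ∘ σ := fun σ => by
    fun_prop
  have hB := hA.inter (measurableSet_strictAnti (n := n))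
  rw [Measure.map_apply measurable_decreasing hA, Measure.smul_apply, Measure.restrict_apply hA]
  -- Away from ties, exactly one permutation sorts the tuple, so the preimage splits into `n!`
  -- disjoint pieces of equal mass by exchangeability.
  have h1 : μ (decreasing ⁻¹' A) =
      μ (⋃ σ : Equiv.Perm (Fin n), (fun x => x ∘ σ) ⁻¹' (A ∩ {x | StrictAnti x}) ∩
        {x | Function.Injective x}) := by
    refine measure_congr (eventuallyEq_set.2 ?_)
    filter_upwards [ae_injective_pi_expMeasure n] with x hx
    simp only [Set.mem_iUnion, Set.mem_inter_iff, Set.mem_preimage, Set.mem_ofPred_eq, hx, and_true]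
    constructor
    · intro h
      exact ⟨Fin.revPerm.trans (Tuple.sort x), h, (antitone_decreasing x).strictAnti_of_injective
        (hx.comp (Equiv.injective (Fin.revPerm.trans (Tuple.sort x))))⟩
    · rintro ⟨σ, h, hσ⟩
      rwa [decreasing_eq_of_antitone hσ.antitone]
  have hinj : MeasurableSet {x : Fin n → ℝ | Function.Injective x} := by
    have : {x : Fin n → ℝ | Function.Injective x} = {x | ∀ i j, x i = x j → i = j} := rfl
    rw [this]
    simp only [Set.ofPred_forall]
    refine .iInter fun i => .iInter fun j => ?_
    by_cases h : i = j
    · simp [h]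
    · simp only [h, imp_false]
      exact (measurableSet_eq_fun (f := fun x : Fin n → ℝ => x _) (measurable_pi_apply _)
        (measurable_pi_apply _)).compl
  rw [h1, measure_iUnion _ fun σ => (hcm σ hB).inter hinj, tsum_fintype]
  · have h2 : ∀ σ : Equiv.Perm (Fin n), μ ((fun x => x ∘ σ) ⁻¹' (A ∩ {x | StrictAnti x}) ∩
        {x | Function.Injective x}) = μ (A ∩ {x | StrictAnti x}) := by
      intro σ
      have h3 := congrArg (fun m => m (A ∩ {x : Fin n → ℝ | StrictAnti x}))
        (map_comp_perm_pi (expMeasure 1) σ)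
      rw [Measure.map_apply (hcm σ) hB] at h3
      rw [← h3]
      refine measure_congr (eventuallyEq_set.2 ?_)
      filter_upwards [ae_injective_pi_expMeasure n] with x hx
      simp [hx]
    simp only [h2]
    simp [Fintype.card_perm]
  · intro σ τ hστ
    rw [Function.onFun, Set.disjoint_left]
    rintro x ⟨⟨_, h1⟩, hx⟩ ⟨⟨_, h2⟩, _⟩
    refine hστ (Equiv.ext fun i => ?_)
    have h3 : StrictAnti (x ∘ σ) := h1
    have h4 : StrictAnti (x ∘ τ) := h2
    exact hx (congrFun (Tuple.unique_antitone h3.antitone h4.antitone) i)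

/-- The matrix of the linear map `x ↦ (∑ j ≥ k, x j / (j + 1))ₖ`. -/
noncomputable def tailMatrix (n : ℕ) : Matrix (Fin n) (Fin n) ℝ :=
  Matrix.of fun k j => if k ≤ j then ((j : ℝ) + 1)⁻¹ else 0

lemma det_tailMatrix_ne_zero (n : ℕ) : (tailMatrix n).det ≠ 0 := by
  rw [Matrix.det_of_isUpperTriangular]
  · refine Finset.prod_ne_zero_iff.2 fun i _ => ?_
    simp only [tailMatrix, Matrix.of_apply, le_refl, if_true]
    positivity
  · intro i j hij
    simp only [id] at hij
    simp [tailMatrix, not_le.2 hij]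

lemma toLin'_tailMatrix (n : ℕ) (x : ℕ → ℝ) (k : Fin n) :
    Matrix.toLin' (tailMatrix n) (fun i => x i) k =
      ∑ j ∈ Finset.Ico (k : ℕ) n, x j / ((j : ℝ) + 1) := by
  rw [Matrix.toLin'_apply, Matrix.mulVec, dotProduct]
  have h := Fin.sum_univ_eq_sum_range
    (fun j => if (k : ℕ) ≤ j then x j / ((j : ℝ) + 1) else 0) n
  have e : Finset.Ico (k : ℕ) n = (Finset.range n).filter fun j => (k : ℕ) ≤ j := by
    ext j; simp [and_comm]
  rw [e, Finset.sum_filter, ← h]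
  refine Finset.sum_congr rfl fun j _ => ?_
  simp only [tailMatrix, Matrix.of_apply, Fin.le_def]
  split_ifs
  · rw [div_eq_inv_mul]
  · simp

/-- The term `x j / (j + 1)` occurs for `k = 0, …, j`, that is `j + 1` times. Hence `tailMatrix`
preserves the sum of the entries, which is the exponent of the joint density. -/
lemma sum_sum_Ico_div (n : ℕ) (x : ℕ → ℝ) :
    ∑ k ∈ Finset.range n, ∑ j ∈ Finset.Ico k n, x j / ((j : ℝ) + 1) =
      ∑ j ∈ Finset.range n, x j := by
  induction n with
  | zero => simp
  | succ n ih =>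
    rw [Finset.sum_range_succ, Finset.sum_range_succ, ← ih]
    have h : ∀ k ∈ Finset.range n, ∑ j ∈ Finset.Ico k (n + 1), x j / ((j : ℝ) + 1) =
        ∑ j ∈ Finset.Ico k n, x j / ((j : ℝ) + 1) + x n / ((n : ℝ) + 1) := fun k hk =>
      Finset.sum_Ico_succ_top (Finset.mem_range.1 hk).le _
    rw [Finset.sum_congr rfl h, Finset.sum_add_distrib]
    have : (n : ℝ) + 1 ≠ 0 := by positivity
    simp
    field_simp
    ring

lemma expDensity_eq_of_nonneg {n : ℕ} {x : Fin n → ℝ} (hx : ∀ i, 0 ≤ x i) :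
    expDensity x = ENNReal.ofReal (Real.exp (-∑ i, x i)) := by
  rw [expDensity, ← Finset.sum_neg_distrib, Real.exp_sum]
  congr 1
  refine Finset.prod_congr rfl fun i _ => ?_
  simp [exponentialPDFReal, gammaPDFReal, hx i]

lemma expDensity_eq_zero {n : ℕ} {x : Fin n → ℝ} {i : Fin n} (hx : x i < 0) :
    expDensity x = 0 := by
  rw [expDensity, Finset.prod_eq_zero (Finset.mem_univ i), ENNReal.ofReal_zero]
  simp [exponentialPDFReal, gammaPDFReal, not_le.2 hx]

/-- Up to null sets, the tuples with positive entries correspond under `tailMatrix` to the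
decreasing tuples with nonnegative entries, and the exponential densities agree. -/
lemma indicator_expDensity_toLin'_tailMatrix {n : ℕ} {t : Fin n → ℝ} (ht : ∀ i, t i ≠ 0) :
    Set.indicator {x : Fin n → ℝ | StrictAnti x} expDensity (Matrix.toLin' (tailMatrix n) t) =
      expDensity t := by
  obtain ⟨x, rfl⟩ : ∃ x : ℕ → ℝ, t = fun i : Fin n => x i :=
    ⟨fun i => if h : i < n then t ⟨i, h⟩ else 0, by simp⟩
  set y := Matrix.toLin' (tailMatrix n) (fun i => x i) with hy
  have hyk : ∀ k : Fin n, y k = ∑ j ∈ Finset.Ico (k : ℕ) n, x j / ((j : ℝ) + 1) :=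
    toLin'_tailMatrix n x
  by_cases hpos : ∀ i : Fin n, 0 < x i
  · have hanti : StrictAnti y := by
      intro k l hkl
      rw [hyk, hyk, ← Finset.sum_Ico_consecutive _ (Fin.lt_def.1 hkl).le l.2.le]
      refine lt_add_of_pos_left _ (Finset.sum_pos (fun j hj => ?_) ⟨k, by simpa using hkl⟩)
      have hj' := Finset.mem_Ico.1 hj
      exact div_pos (hpos ⟨j, hj'.2.trans l.2⟩) (by positivity)
    have hnn : ∀ k, 0 ≤ y k := by
      intro k
      rw [hyk]
      refine Finset.sum_nonneg fun j hj => ?_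
      exact (div_pos (hpos ⟨j, (Finset.mem_Ico.1 hj).2⟩) (by positivity)).le
    rw [Set.indicator_of_mem (by exact hanti), expDensity_eq_of_nonneg hnn,
      expDensity_eq_of_nonneg fun i => (hpos i).le]
    congr 3
    rw [Fin.sum_univ_eq_sum_range x n, ← sum_sum_Ico_div, ← Fin.sum_univ_eq_sum_range]
    exact Finset.sum_congr rfl fun k _ => hyk k
  · push Not at hpos
    obtain ⟨i, hi⟩ := hpos
    have hi' : x i < 0 := lt_of_le_of_ne hi (ht i)
    rw [expDensity_eq_zero (i := i) hi']
    by_cases hanti : StrictAnti y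
    · rw [Set.indicator_of_mem (by exact hanti)]
      have hrec : y i = x i / ((i : ℝ) + 1) +
          ∑ j ∈ Finset.Ico ((i : ℕ) + 1) n, x j / ((j : ℝ) + 1) := by
        rw [hyk, Finset.sum_eq_sum_Ico_succ_bot i.2]
      have hneg : x i / ((i : ℝ) + 1) < 0 := div_neg_of_neg_of_pos hi' (by positivity)
      -- A negative `x i` makes `y i` smaller than `y (i + 1)`, against strict decrease, or, when
      -- `i` is the last index, makes `y i` itself negative, where the density vanishes.
      by_cases hin : (i : ℕ) + 1 < n
      · have h1 := hanti (show i < ⟨(i : ℕ) + 1, hin⟩ from Fin.lt_def.2 (Nat.lt_succ_self _))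
        rw [hrec, hyk] at h1
        simp only at h1
        linarith
      · rw [Finset.Ico_eq_empty (by omega), Finset.sum_empty, add_zero] at hrec
        exact expDensity_eq_zero (i := i) (hrec ▸ hneg)
    · rw [Set.indicator_of_notMem (by exact hanti)]

/-- **Rényi's representation** of the order statistics of independent `Exp(1)` variables. -/
lemma map_decreasing_eq_map_tailMatrix (n : ℕ) :
    (Measure.pi (fun _ : Fin n => expMeasure 1)).map decreasing =
      (Measure.pi (fun _ : Fin n => expMeasure 1)).map (Matrix.toLin' (tailMatrix n)) := by
  have hLm : Measurable (Matrix.toLin' (tailMatrix n)) :=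
    (LinearMap.continuous_of_finiteDimensional _).measurable
  have hSA := measurableSet_strictAnti (n := n)
  set q : (Fin n → ℝ) → ENNReal := Set.indicator {x | StrictAnti x} expDensity with hq
  have hqm : Measurable q := measurable_expDensity.indicator hSA
  set ν := (volume : Measure (Fin n → ℝ)).withDensity q with hν
  have h1 : (Measure.pi (fun _ : Fin n => expMeasure 1)).map decreasing =
      (n.factorial : ENNReal) • ν := by
    rw [map_decreasing_pi, pi_expMeasure_eq_withDensity, restrict_withDensity hSA, hν, hq,
      withDensity_indicator hSA]
  obtain ⟨c, h2⟩ : ∃ c : ENNReal,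
      (Measure.pi (fun _ : Fin n => expMeasure 1)).map (Matrix.toLin' (tailMatrix n)) = c • ν := by
    refine ⟨ENNReal.ofReal |(tailMatrix n).det⁻¹|, ?_⟩
    ext A hA
    have hae : ∀ᵐ t : Fin n → ℝ, expDensity t = q (Matrix.toLin' (tailMatrix n) t) := by
      have : ∀ᵐ t : Fin n → ℝ, ∀ i, t i ≠ 0 := by
        rw [ae_all_iff]
        intro i
        exact Measure.ae_eval_ne (μ := fun _ : Fin n => (volume : Measure ℝ)) i 0
      filter_upwards [this] with t ht
      exact (indicator_expDensity_toLin'_tailMatrix ht).symm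
    rw [Measure.map_apply hLm hA, pi_expMeasure_eq_withDensity, withDensity_congr_ae hae,
      withDensity_apply _ (hLm hA), Measure.smul_apply, hν, withDensity_apply _ hA,
      ← lintegral_indicator (hLm hA), ← lintegral_indicator hA, smul_eq_mul]
    have h3 := Real.map_matrix_volume_pi_eq_smul_volume_pi (det_tailMatrix_ne_zero n)
    have h4 := congrArg (fun m => ∫⁻ x, A.indicator q x ∂m) h3
    rw [lintegral_map (hqm.indicator hA) hLm, lintegral_smul_measure, smul_eq_mul] at h4
    exact h4
  -- The constants `n!` and `c` need not be compared by computing the determinant: both laws are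
  -- probability measures, so each constant is the inverse of the mass of `ν`.
  have p1 : IsProbabilityMeasure ((Measure.pi (fun _ : Fin n => expMeasure 1)).map decreasing) :=
    Measure.isProbabilityMeasure_map measurable_decreasing.aemeasurable
  have p2 : IsProbabilityMeasure
      ((Measure.pi (fun _ : Fin n => expMeasure 1)).map (Matrix.toLin' (tailMatrix n))) :=
    Measure.isProbabilityMeasure_map hLm.aemeasurable
  have e1 := measure_univ (μ := (Measure.pi (fun _ : Fin n => expMeasure 1)).map decreasing)
  have e2 := measure_univ
    (μ := (Measure.pi (fun _ : Fin n => expMeasure 1)).map (Matrix.toLin' (tailMatrix n)))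
  rw [h1, Measure.smul_apply, smul_eq_mul] at e1
  rw [h2, Measure.smul_apply, smul_eq_mul] at e2
  rw [h1, h2, ENNReal.eq_inv_of_mul_eq_one_left e1, ENNReal.eq_inv_of_mul_eq_one_left e2]

/-- The partial tails `∑ k ≤ j < n, x j / (j + 1)`. -/
noncomputable def harmonicTail (n : ℕ) (x : ℕ → ℝ) (k : ℕ) : ℝ :=
  ∑ j ∈ Finset.Ico k n, x j / ((j : ℝ) + 1)

lemma measurable_harmonicTail (n : ℕ) : Measurable (harmonicTail n) := by
  unfold harmonicTail
  fun_prop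

lemma harmonicTail_eq (n : ℕ) (x : ℕ → ℝ) (k : ℕ) :
    harmonicTail n x k = if h : k < n then
      Matrix.toLin' (tailMatrix n) (fun i => x i) ⟨k, h⟩ else 0 := by
  split_ifs with h
  · rw [toLin'_tailMatrix]; rfl
  · rw [harmonicTail, Finset.Ico_eq_empty (by omega), Finset.sum_empty]

lemma measurable_extend (n : ℕ) :
    Measurable fun (y : Fin n → ℝ) (k : ℕ) => if h : k < n then y ⟨k, h⟩ else 0 := by
  refine measurable_pi_lambda _ fun k => ?_
  by_cases h : k < n
  · simpa [h] using measurable_pi_apply _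
  · simp [h]

lemma measurable_kthLargest (n : ℕ) :
    Measurable fun (x : ℕ → ℝ) (k : ℕ) => kthLargest n k x :=
  ((measurable_extend n).comp measurable_decreasing).comp
    (f := fun (x : ℕ → ℝ) (i : Fin n) => x i) (by fun_prop)

lemma map_restrict_expSeq (n : ℕ) :
    expSeq.map (fun (x : ℕ → ℝ) (i : Fin n) => x i) = Measure.pi (fun _ : Fin n => expMeasure 1) :=
  ((iIndepFun_eval_expSeq.precomp (g := fun i : Fin n => (i : ℕ))
    Fin.val_injective).hasLaw_pi (X := fun (i : Fin n) (x : ℕ → ℝ) => x i)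
    fun i => hasLaw_eval_expSeq i).map_eq

/-- The order statistics of `n` independent `Exp(1)` variables have the joint law of the sums
`∑ k ≤ j < n, x j / (j + 1)`. -/
lemma map_kthLargest_expSeq (n : ℕ) :
    expSeq.map (fun x k => kthLargest n k x) = expSeq.map (harmonicTail n) := by
  have hr : Measurable fun (x : ℕ → ℝ) (i : Fin n) => x i := by fun_prop
  have hLm : Measurable (Matrix.toLin' (tailMatrix n)) :=
    (LinearMap.continuous_of_finiteDimensional _).measurable
  have e : harmonicTail n = ((fun (y : Fin n → ℝ) (k : ℕ) => if h : k < n then y ⟨k, h⟩ else 0) ∘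
      Matrix.toLin' (tailMatrix n)) ∘ fun (x : ℕ → ℝ) (i : Fin n) => x i := by
    funext x k
    exact harmonicTail_eq n x k
  change expSeq.map (((fun (y : Fin n → ℝ) (k : ℕ) => if h : k < n then y ⟨k, h⟩ else 0) ∘
      decreasing) ∘ fun (x : ℕ → ℝ) (i : Fin n) => x i) = _
  rw [e, ← Measure.map_map ((measurable_extend n).comp measurable_decreasing) hr,
    ← Measure.map_map ((measurable_extend n).comp hLm) hr, map_restrict_expSeq,
    ← Measure.map_map (measurable_extend n) measurable_decreasing,
    ← Measure.map_map (measurable_extend n) hLm, map_decreasing_eq_map_tailMatrix]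

/-! ### Moments and moment generating functions. -/

lemma toReal_gammaPDF_eq_indicator {a x : ℝ} (ha : 0 < a) (hx : x ≠ 0) :
    (gammaPDF a 1 x).toReal =
      (Set.Ioi 0).indicator (fun x => x ^ (a - 1) * Real.exp (-x) / Real.Gamma a) x := by
  rw [gammaPDF, ENNReal.toReal_ofReal (gammaPDFReal_nonneg ha one_pos x), gammaPDFReal]
  by_cases h : 0 < x
  · rw [if_pos h.le, Set.indicator_of_mem (Set.mem_Ioi.2 h)]
    simp
    ring
  · rw [if_neg fun h' => h (lt_of_le_of_ne h' hx.symm), Set.indicator_of_notMem (by simpa using h)]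

lemma toReal_gammaPDF_smul_ae {a : ℝ} (ha : 0 < a) {E : Type*} [NormedAddCommGroup E]
    [NormedSpace ℝ E] (f : ℝ → E) :
    (fun x => (gammaPDF a 1 x).toReal • f x) =ᵐ[volume]
      (Set.Ioi 0).indicator fun x => (x ^ (a - 1) * Real.exp (-x) / Real.Gamma a) • f x := by
  -- The two sides may differ at `0`, which `gammaPDF` treats as part of the support.
  have h0 : ∀ᵐ x : ℝ, x ≠ 0 := by simp [ae_iff]
  filter_upwards [h0] with x hx
  rw [toReal_gammaPDF_eq_indicator ha hx, Set.indicator_smul_apply_left]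

lemma integrable_gammaMeasure_iff {a : ℝ} (ha : 0 < a) {E : Type*} [NormedAddCommGroup E]
    [NormedSpace ℝ E] {f : ℝ → E} :
    Integrable f (gammaMeasure a 1) ↔
      IntegrableOn (fun x => (x ^ (a - 1) * Real.exp (-x) / Real.Gamma a) • f x) (Set.Ioi 0) := by
  have hm : Measurable (gammaPDF a 1) := (measurable_gammaPDFReal a 1).ennreal_ofReal
  rw [gammaMeasure, integrable_withDensity_iff_integrable_smul' hm
    (Eventually.of_forall fun x => ENNReal.ofReal_lt_top),
    integrable_congr (toReal_gammaPDF_smul_ae ha f), integrable_indicator_iff measurableSet_Ioi]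

lemma integral_gammaMeasure_eq {a : ℝ} (ha : 0 < a) {E : Type*} [NormedAddCommGroup E]
    [NormedSpace ℝ E] (f : ℝ → E) :
    ∫ x, f x ∂gammaMeasure a 1 =
      ∫ x in Set.Ioi 0, (x ^ (a - 1) * Real.exp (-x) / Real.Gamma a) • f x := by
  have hm : Measurable (gammaPDF a 1) := (measurable_gammaPDFReal a 1).ennreal_ofReal
  rw [gammaMeasure, integral_withDensity_eq_integral_toReal_smul hm
    (Eventually.of_forall fun x => ENNReal.ofReal_lt_top),
    integral_congr_ae (toReal_gammaPDF_smul_ae ha f), integral_indicator measurableSet_Ioi]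

/-- The factor `exp (-s log x)` is the power `x ^ (-s)`, so it only shifts the exponent; what
remains is the integrand of `Γ(a - s)`. -/
lemma gamma_density_smul_exp_neg_log {a x : ℝ} (hx : 0 < x) (s : ℂ) :
    (x ^ (a - 1) * Real.exp (-x) / Real.Gamma a) • Complex.exp (s * (-Real.log x : ℝ)) =
      (Real.exp (-x) * (x : ℂ) ^ ((a : ℂ) - s - 1)) * (Complex.Gamma a)⁻¹ := by
  have hx' : (x : ℂ) ≠ 0 := by exact_mod_cast hx.ne'
  have e1 : (x : ℂ) ^ ((a : ℂ) - s - 1) = ((x ^ (a - 1) : ℝ) : ℂ) *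
      Complex.exp (s * (-Real.log x : ℝ)) := by
    rw [Complex.ofReal_cpow hx.le, Complex.cpow_def_of_ne_zero hx', Complex.cpow_def_of_ne_zero hx',
      ← Complex.exp_add, ← Complex.ofReal_log hx.le]
    congr 1
    push_cast
    ring
  rw [e1, Complex.Gamma_ofReal, Complex.real_smul]
  push_cast
  ring

/-- The moment generating function of `-log X` for `X` of law `Gamma(a)`. -/
lemma integrable_exp_neg_log_gammaMeasure {a : ℝ} (ha : 0 < a) {s : ℂ} (hs : s.re < a) :
    Integrable (fun x : ℝ => Complex.exp (s * (-Real.log x : ℝ))) (gammaMeasure a 1) := by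
  rw [integrable_gammaMeasure_iff ha]
  have h := (Complex.GammaIntegral_convergent (s := (a : ℂ) - s) (by simpa using hs)).mul_const
    (Complex.Gamma a)⁻¹
  exact IntegrableOn.congr_fun h (fun x hx => (gamma_density_smul_exp_neg_log hx s).symm)
    measurableSet_Ioi

lemma integral_exp_neg_log_gammaMeasure {a : ℝ} (ha : 0 < a) {s : ℂ} (hs : s.re < a) :
    ∫ x : ℝ, Complex.exp (s * (-Real.log x : ℝ)) ∂gammaMeasure a 1 =
      Complex.Gamma (a - s) / Complex.Gamma a := by
  rw [integral_gammaMeasure_eq ha, setIntegral_congr_fun measurableSet_Ioi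
    (fun x hx => gamma_density_smul_exp_neg_log hx s), integral_mul_const,
    Complex.Gamma_eq_integral (s := a - s) (by simpa using hs), div_eq_mul_inv]
  rfl

lemma exp_density_smul_exp (z : ℂ) (x : ℝ) :
    (x ^ ((1 : ℝ) - 1) * Real.exp (-x) / Real.Gamma 1) • Complex.exp (z * x) =
      Complex.exp ((z - 1) * x) := by
  rw [sub_self, Real.rpow_zero, one_mul, Real.Gamma_one, div_one, Complex.real_smul,
    Complex.ofReal_exp, ← Complex.exp_add]
  congr 1
  push_cast
  ring

lemma integrable_exp_mul_expMeasure {z : ℂ} (hz : z.re < 1) :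
    Integrable (fun x : ℝ => Complex.exp (z * x)) (expMeasure 1) := by
  rw [expMeasure, integrable_gammaMeasure_iff one_pos]
  simp only [exp_density_smul_exp]
  exact integrableOn_exp_mul_complex_Ioi (by simpa using hz) 0

lemma integral_exp_mul_expMeasure {z : ℂ} (hz : z.re < 1) :
    ∫ x : ℝ, Complex.exp (z * x) ∂expMeasure 1 = (1 - z)⁻¹ := by
  rw [expMeasure, integral_gammaMeasure_eq one_pos]
  simp only [exp_density_smul_exp]
  rw [integral_exp_mul_complex_Ioi (by simpa using hz)]
  have : 1 - z ≠ 0 := by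
    intro h
    have : z = 1 := by linear_combination -h
    simp [this] at hz
  have h2 : z - 1 ≠ 0 := by
    intro h
    exact this (by linear_combination -h)
  simp
  field_simp
  ring

lemma exp_density_smul_pow (p : ℕ) (x : ℝ) :
    (x ^ ((1 : ℝ) - 1) * Real.exp (-x) / Real.Gamma 1) • x ^ p =
      Real.exp (-x) * x ^ (((p : ℝ) + 1) - 1) := by
  simp

lemma integrable_pow_expMeasure (p : ℕ) : Integrable (fun x : ℝ => x ^ p) (expMeasure 1) := by
  rw [expMeasure, integrable_gammaMeasure_iff one_pos]
  simp only [exp_density_smul_pow]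
  exact Real.GammaIntegral_convergent (by positivity)

lemma integral_pow_expMeasure (p : ℕ) : ∫ x : ℝ, x ^ p ∂expMeasure 1 = (p.factorial : ℝ) := by
  rw [expMeasure, integral_gammaMeasure_eq one_pos]
  simp only [exp_density_smul_pow]
  rw [← Real.Gamma_nat_eq_factorial, Real.Gamma_eq_integral (by positivity)]

lemma integral_id_expMeasure : ∫ x : ℝ, x ∂expMeasure 1 = 1 := by
  simpa using integral_pow_expMeasure 1

lemma memLp_two_expMeasure : MemLp (fun x : ℝ => x) 2 (expMeasure 1) := by
  rw [memLp_two_iff_integrable_sq (by fun_prop)]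
  exact integrable_pow_expMeasure 2

lemma variance_expMeasure : Var[fun x : ℝ => x; expMeasure 1] = 1 := by
  rw [variance_eq_sub memLp_two_expMeasure, integral_id_expMeasure]
  have := integral_pow_expMeasure 2
  simp only [Pi.pow_apply, this]
  norm_num

lemma memLp_eval_expSeq (i : ℕ) : MemLp (fun x : ℕ → ℝ => x i) 2 expSeq :=
  memLp_two_expMeasure.comp_measurePreserving
    (measurePreserving_eval_infinitePi (fun _ : ℕ => expMeasure 1) i)

lemma integral_eval_expSeq (i : ℕ) : ∫ x : ℕ → ℝ, x i ∂expSeq = 1 := by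
  rw [(hasLaw_eval_expSeq i).integral_eq, integral_id_expMeasure]

lemma variance_eval_expSeq (i : ℕ) : Var[fun x : ℕ → ℝ => x i; expSeq] = 1 := by
  rw [(hasLaw_eval_expSeq i).variance_eq]
  exact variance_expMeasure

lemma hasLaw_restrict_expSeq (n : ℕ) :
    HasLaw (fun (x : ℕ → ℝ) (i : Fin n) => x i) (Measure.pi (fun _ : Fin n => expMeasure 1))
      expSeq :=
  ⟨Measurable.aemeasurable (by fun_prop), map_restrict_expSeq n⟩

/-- The product runs over all of `Fin n`, with exponent `0` below `k`, so that Fubini on the finite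
product measure applies directly. -/
lemma exp_mul_harmonicTail (s : ℂ) (n k : ℕ) (x : ℕ → ℝ) :
    Complex.exp (s * (harmonicTail n x k : ℝ)) =
      ∏ i : Fin n, Complex.exp ((if k ≤ (i : ℕ) then s / ((i : ℂ) + 1) else 0) * (x i : ℝ)) := by
  rw [← Complex.exp_sum, Fin.sum_univ_eq_sum_range
    (fun i => (if k ≤ i then s / ((i : ℂ) + 1) else 0) * (x i : ℂ)), harmonicTail]
  have e : Finset.Ico k n = (Finset.range n).filter fun j => k ≤ j := by
    ext j; simp [and_comm]
  rw [e, Finset.sum_filter]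
  push_cast
  rw [Finset.mul_sum]
  congr 1
  refine Finset.sum_congr rfl fun i _ => ?_
  split_ifs
  · push_cast
    ring
  · simp

lemma re_div_natCast_add_one_lt {s : ℂ} {k i : ℕ} (hs : s.re < (k : ℝ) + 1) :
    (if k ≤ i then s / ((i : ℂ) + 1) else 0).re < 1 := by
  split_ifs with h
  · have e : s / ((i : ℂ) + 1) = s / (((i : ℝ) + 1 : ℝ) : ℂ) := by push_cast; rfl
    rw [e, Complex.div_ofReal_re, div_lt_one (by positivity)]
    have : (k : ℝ) ≤ i := by exact_mod_cast h
    linarith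
  · simp

lemma natCast_add_one_sub_ne_zero {s : ℂ} {k i : ℕ} (hs : s.re < (k : ℝ) + 1) (h : k ≤ i) :
    (i : ℂ) + 1 - s ≠ 0 := by
  intro h0
  have h1 : s = (i : ℂ) + 1 := by linear_combination -h0
  have : (k : ℝ) ≤ i := by exact_mod_cast h
  rw [h1] at hs
  simp at hs
  linarith

lemma integrable_exp_mul_harmonicTail {s : ℂ} {k : ℕ} (hs : s.re < (k : ℝ) + 1) (n : ℕ) :
    Integrable (fun x => Complex.exp (s * (harmonicTail n x k : ℝ))) expSeq := by
  simp only [exp_mul_harmonicTail]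
  have h : Integrable (fun y : Fin n → ℝ =>
      ∏ i : Fin n, Complex.exp ((if k ≤ (i : ℕ) then s / ((i : ℂ) + 1) else 0) * (y i : ℝ)))
      (Measure.pi (fun _ : Fin n => expMeasure 1)) :=
    Integrable.fintype_prod (f := fun (i : Fin n) (t : ℝ) =>
      Complex.exp ((if k ≤ (i : ℕ) then s / ((i : ℂ) + 1) else 0) * t)) fun i =>
      integrable_exp_mul_expMeasure (re_div_natCast_add_one_lt hs)
  rw [← map_restrict_expSeq] at h
  exact h.comp_measurable (f := fun (x : ℕ → ℝ) (i : Fin n) => x i) (by fun_prop)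

lemma integral_exp_mul_harmonicTail {s : ℂ} {n k : ℕ} (hs : s.re < (k : ℝ) + 1) :
    ∫ x, Complex.exp (s * (harmonicTail n x k : ℝ)) ∂expSeq =
      ∏ j ∈ Finset.Ico k n, ((j : ℂ) + 1) / ((j : ℂ) + 1 - s) := by
  simp only [exp_mul_harmonicTail]
  have h := (hasLaw_restrict_expSeq n).integral_comp (f := fun y : Fin n → ℝ =>
      ∏ i : Fin n, Complex.exp ((if k ≤ (i : ℕ) then s / ((i : ℂ) + 1) else 0) * (y i : ℝ)))
      (Continuous.aestronglyMeasurable (by fun_prop))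
  refine h.trans ?_
  rw [integral_fintype_prod_eq_prod (fun (i : Fin n) (t : ℝ) =>
      Complex.exp ((if k ≤ (i : ℕ) then s / ((i : ℂ) + 1) else 0) * t))]
  simp only [integral_exp_mul_expMeasure (re_div_natCast_add_one_lt hs)]
  rw [Fin.prod_univ_eq_prod_range
    (fun i => (1 - if k ≤ i then s / ((i : ℂ) + 1) else 0)⁻¹)]
  have e : Finset.Ico k n = (Finset.range n).filter fun j => k ≤ j := by
    ext j; simp [and_comm]
  rw [e, Finset.prod_filter]
  refine Finset.prod_congr rfl fun i _ => ?_
  split_ifs with hi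
  · have h1 := natCast_add_one_sub_ne_zero hs hi
    have h2 : (i : ℂ) + 1 ≠ 0 := Nat.cast_add_one_ne_zero i
    rw [← inv_div _ ((i : ℂ) + 1), sub_div, div_self h2]
  · simp

/-- The recursion `Γ(z + 1) = z Γ(z)` in numerator and denominator; `re s < k + 1` keeps every
argument away from the poles. -/
lemma prod_Ico_div_sub_eq_Gamma {s : ℂ} {n k : ℕ} (hs : s.re < (k : ℝ) + 1) (hk : k ≤ n) :
    ∏ j ∈ Finset.Ico k n, ((j : ℂ) + 1) / ((j : ℂ) + 1 - s) =
      Complex.Gamma ((n : ℂ) + 1) * Complex.Gamma ((k : ℂ) + 1 - s) /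
        (Complex.Gamma ((k : ℂ) + 1) * Complex.Gamma ((n : ℂ) + 1 - s)) := by
  have hg : ∀ m : ℕ, k ≤ m → Complex.Gamma ((m : ℂ) + 1 - s) ≠ 0 := by
    intro m hm
    refine Complex.Gamma_ne_zero_of_re_pos ?_
    have : (k : ℝ) ≤ m := by exact_mod_cast hm
    simp
    linarith
  have hg' : ∀ m : ℕ, Complex.Gamma ((m : ℂ) + 1) ≠ 0 := fun m => by
    rw [Complex.Gamma_nat_eq_factorial]
    exact_mod_cast m.factorial_ne_zero
  induction n, hk using Nat.le_induction with
  | base =>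
    have h1 := hg k le_rfl
    have h2 := hg' k
    rw [Finset.Ico_self, Finset.prod_empty, div_self (mul_ne_zero h2 h1)]
  | succ n hk ih =>
    rw [Finset.prod_Ico_succ_top hk, ih]
    have h3 := natCast_add_one_sub_ne_zero hs hk
    have h4 : (n : ℂ) + 1 ≠ 0 := Nat.cast_add_one_ne_zero n
    have e1 : ((n + 1 : ℕ) : ℂ) + 1 - s = ((n : ℂ) + 1 - s) + 1 := by push_cast; ring
    have e2 : ((n + 1 : ℕ) : ℂ) + 1 = ((n : ℂ) + 1) + 1 := by push_cast; ring
    rw [e1, e2, Complex.Gamma_add_one _ h3, Complex.Gamma_add_one _ h4]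
    have h1 := hg n hk
    have h2 := hg' k
    field_simp

lemma integrable_harmonicTail (n k : ℕ) : Integrable (fun x => harmonicTail n x k) expSeq :=
  integrable_finsetSum _ fun i _ => ((memLp_eval_expSeq i).integrable one_le_two).div_const _

lemma harmonic_eq_sum_div (n : ℕ) :
    (harmonic n : ℝ) = ∑ j ∈ Finset.range n, 1 / ((j : ℝ) + 1) := by
  simp [harmonic]

lemma sum_Ico_one_div {n k : ℕ} (hk : k ≤ n) :
    ∑ j ∈ Finset.Ico k n, 1 / ((j : ℝ) + 1) = (harmonic n : ℝ) - (harmonic k : ℝ) := by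
  rw [harmonic_eq_sum_div, harmonic_eq_sum_div, Finset.sum_Ico_eq_sub _ hk]

lemma integral_harmonicTail {n k : ℕ} (hk : k ≤ n) :
    ∫ x, harmonicTail n x k ∂expSeq = (harmonic n : ℝ) - (harmonic k : ℝ) := by
  unfold harmonicTail
  rw [integral_finsetSum _ fun i _ => ((memLp_eval_expSeq i).integrable one_le_two).div_const _,
    ← sum_Ico_one_div hk]
  simp only [integral_div, integral_eval_expSeq]

/-! ### Almost sure convergence to `negLogSum`. -/

/-- The sequence `-log (x 0), -log (x 0 + x 1), …`. -/
noncomputable def negLogSum (x : ℕ → ℝ) (k : ℕ) : ℝ :=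
  -Real.log (∑ i ∈ Finset.range (k + 1), x i)

lemma measurable_negLogSum : Measurable negLogSum := by
  unfold negLogSum
  fun_prop

/-- The weight `1 / (j + 1)` cancels the scaling in `logIncr`, and the logarithms telescope. -/
lemma harmonicTail_logIncr {n k : ℕ} (hk : k ≤ n) (x : ℕ → ℝ) :
    harmonicTail n (logIncr x) k =
      Real.log (∑ i ∈ Finset.range (n + 1), x i) + negLogSum x k := by
  have h := Finset.sum_Ico_sub
    (fun m => Real.log (∑ i ∈ Finset.range (m + 1), x i)) hk
  rw [negLogSum, ← sub_eq_add_neg, ← h, harmonicTail]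
  refine Finset.sum_congr rfl fun j _ => ?_
  have : (j : ℝ) + 1 ≠ 0 := by positivity
  rw [logIncr]
  field_simp

lemma ae_tendsto_log_sum_sub_log :
    ∀ᵐ x ∂expSeq, Tendsto (fun n : ℕ =>
      Real.log (∑ i ∈ Finset.range (n + 1), x i) - Real.log n) atTop (𝓝 0) := by
  have h := strong_law_ae_real (fun (i : ℕ) (x : ℕ → ℝ) => x i)
    ((memLp_eval_expSeq 0).integrable one_le_two)
    (fun i j hij => iIndepFun_eval_expSeq.indepFun hij)
    (fun i => (hasLaw_eval_expSeq i).identDistrib (hasLaw_eval_expSeq 0))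
  rw [integral_eval_expSeq] at h
  filter_upwards [h, ae_pos_expSeq] with x hx hpos
  have h1 := ((Real.continuousAt_log one_ne_zero).tendsto.comp (hx.comp (tendsto_add_atTop_nat 1)))
  -- The sum has `n + 1` terms, so the strong law compares it with `n + 1`; the remaining `log (n +
  -- 1) - log n` tends to `0`.
  have h2 := h1.add Real.tendsto_log_nat_add_one_sub_log
  rw [Real.log_one, add_zero] at h2
  refine h2.congr fun n => ?_
  have hs : 0 < ∑ i ∈ Finset.range (n + 1), x i :=
    Finset.sum_pos (fun i _ => hpos i) ⟨0, by simp⟩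
  simp only [Function.comp_apply]
  rw [Real.log_div hs.ne' (by positivity)]
  push_cast
  ring

lemma ae_tendsto_harmonicTail_logIncr :
    ∀ᵐ x ∂expSeq, ∀ k, Tendsto (fun n : ℕ => harmonicTail n (logIncr x) k - Real.log n) atTop
      (𝓝 (negLogSum x k)) := by
  filter_upwards [ae_tendsto_log_sum_sub_log] with x hx k
  have h := hx.add_const (negLogSum x k)
  rw [zero_add] at h
  refine h.congr' ?_
  filter_upwards [eventually_ge_atTop k] with n hn
  rw [harmonicTail_logIncr hn]
  ring

/-! ### The centred series: convergence, joint law and mean. -/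

/-- The sums `∑ k ≤ j < N, (x j - 1) / (j + 1)`. -/
noncomputable def centredTail (N : ℕ) (x : ℕ → ℝ) (k : ℕ) : ℝ :=
  ∑ i ∈ Finset.Ico k N, (x i - 1) / ((i : ℝ) + 1)

lemma centredTail_eq {N k : ℕ} (hk : k ≤ N) (x : ℕ → ℝ) :
    centredTail N x k = harmonicTail N x k - ((harmonic N : ℝ) - (harmonic k : ℝ)) := by
  rw [← sum_Ico_one_div hk, centredTail, harmonicTail, ← Finset.sum_sub_distrib]
  exact Finset.sum_congr rfl fun i _ => sub_div _ _ _

lemma measurable_centredTail (N k : ℕ) : Measurable fun x => centredTail N x k := by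
  unfold centredTail
  fun_prop

/-- The sum of the series `∑ j ≥ k, (x j - 1) / (j + 1)`. -/
noncomputable def centredSeries (x : ℕ → ℝ) (k : ℕ) : ℝ :=
  limUnder atTop fun N => centredTail N x k

lemma measurable_centredSeries : Measurable centredSeries := by
  refine measurable_pi_lambda _ fun k => ?_
  exact (StronglyMeasurable.limUnder fun N =>
    (measurable_centredTail N k).stronglyMeasurable).measurable

lemma ae_tendsto_centredTail_logIncr :
    ∀ᵐ x ∂expSeq, ∀ k, Tendsto (fun N => centredTail N (logIncr x) k) atTop
      (𝓝 (negLogSum x k - Real.eulerMascheroniConstant + (harmonic k : ℝ))) := by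
  filter_upwards [ae_tendsto_harmonicTail_logIncr] with x hx k
  refine (((hx k).sub Real.tendsto_harmonic_sub_log).add_const (harmonic k : ℝ)).congr' ?_
  filter_upwards [eventually_ge_atTop k] with N hN
  rw [centredTail_eq hN]
  ring

/-- Convergence is a measurable event, known almost surely along `logIncr x`; invariance of `expSeq`
transfers it to `x`. -/
lemma ae_tendsto_centredTail :
    ∀ᵐ x ∂expSeq, ∀ k, Tendsto (fun N => centredTail N x k) atTop (𝓝 (centredSeries x k)) := by
  rw [ae_all_iff]
  intro k
  have hm : MeasurableSet {x | ∃ l, Tendsto (fun N => centredTail N x k) atTop (𝓝 l)} :=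
    MeasureTheory.measurableSet_exists_tendsto fun N => measurable_centredTail N k
  have h : ∀ᵐ x ∂expSeq, ∃ l, Tendsto (fun N => centredTail N x k) atTop (𝓝 l) := by
    rw [← map_logIncr_expSeq, ae_map_iff measurable_logIncr.aemeasurable hm]
    filter_upwards [ae_tendsto_centredTail_logIncr] with x hx
    exact ⟨_, hx k⟩
  filter_upwards [h] with x hx
  exact tendsto_nhds_limUnder hx

/-- The centred series have the joint law of the centred variables `-log (x 0 + … + x k)`. -/
lemma identDistrib_centredSeries :
    IdentDistrib centredSeries
      (fun x k => negLogSum x k - Real.eulerMascheroniConstant + (harmonic k : ℝ))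
      expSeq expSeq := by
  refine ⟨measurable_centredSeries.aemeasurable, ?_, ?_⟩
  · refine Measurable.aemeasurable ?_
    refine measurable_pi_lambda _ fun k => ?_
    exact (((measurable_pi_apply k).comp measurable_negLogSum).sub_const _).add_const _
  · conv_lhs => rw [← map_logIncr_expSeq,
      Measure.map_map measurable_centredSeries measurable_logIncr]
    refine Measure.map_congr ?_
    filter_upwards [ae_tendsto_centredTail_logIncr] with x hx
    funext k
    exact (hx k).limUnder_eq

lemma memLp_harmonicTail (n k : ℕ) : MemLp (fun x => harmonicTail n x k) 2 expSeq := by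
  unfold harmonicTail
  exact memLp_finsetSum _ fun i _ => by
    simpa [div_eq_mul_inv] using (memLp_eval_expSeq i).mul_const (((i : ℝ) + 1)⁻¹)

lemma variance_harmonicTail (n k : ℕ) :
    Var[fun x => harmonicTail n x k; expSeq] =
      ∑ j ∈ Finset.Ico k n, 1 / ((j : ℝ) + 1) ^ 2 := by
  have h := IndepFun.variance_sum (μ := expSeq) (s := Finset.Ico k n)
    (X := fun (i : ℕ) (x : ℕ → ℝ) => x i * ((i : ℝ) + 1)⁻¹)
    (fun i _ => (memLp_eval_expSeq i).mul_const _)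
    (fun i _ j _ hij => (iIndepFun_eval_expSeq.indepFun hij).comp
      (measurable_id.mul_const (((i : ℝ) + 1)⁻¹)) (measurable_id.mul_const (((j : ℝ) + 1)⁻¹)))
  simp only [variance_mul_const, variance_eval_expSeq] at h
  have e : (∑ i ∈ Finset.Ico k n, fun x : ℕ → ℝ => x i * ((i : ℝ) + 1)⁻¹) =
      fun x => harmonicTail n x k := by
    funext x
    simp [harmonicTail, div_eq_mul_inv]
  rw [← e, h]
  refine Finset.sum_congr rfl fun j _ => ?_
  simp

/-- Comparison with the telescoping series of `1 / (j (j + 1))`. -/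
lemma sum_Ico_one_div_sq_le {N M : ℕ} (hN : 0 < N) (hM : N ≤ M) :
    ∑ j ∈ Finset.Ico N M, 1 / ((j : ℝ) + 1) ^ 2 ≤ 1 / (N : ℝ) := by
  have h1 : ∑ j ∈ Finset.Ico N M, 1 / ((j : ℝ) + 1) ^ 2 ≤
      ∑ j ∈ Finset.Ico N M, ((-1 / ((j + 1 : ℕ) : ℝ)) - (-1 / (j : ℝ))) := by
    refine Finset.sum_le_sum fun j hj => ?_
    have hj0 : (0 : ℝ) < j := by
      have := (Finset.mem_Ico.1 hj).1
      exact_mod_cast hN.trans_le this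
    push_cast
    have : -1 / ((j : ℝ) + 1) - -1 / (j : ℝ) = 1 / (j * (j + 1)) := by
      field_simp
      ring
    rw [this]
    refine one_div_le_one_div_of_le (by positivity) ?_
    nlinarith
  refine h1.trans ?_
  rw [Finset.sum_Ico_sub (fun j : ℕ => -1 / (j : ℝ)) hM]
  have h2 : -1 / (M : ℝ) ≤ 0 := div_nonpos_of_nonpos_of_nonneg (by norm_num) (by positivity)
  have h3 : -1 / (N : ℝ) = -(1 / N) := neg_div _ _
  linarith

/-- The difference is, up to sign, the centred variable `harmonicTail M x N`, so its `L²` norm is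
the square root of a variance. -/
lemma eLpNorm_centredTail_sub {k N M : ℕ} (hk : k ≤ N) (hN : 0 < N) (hM : N ≤ M) :
    eLpNorm (fun x => centredTail N x k - centredTail M x k) 2 expSeq ≤
      ENNReal.ofReal (Real.sqrt (1 / N)) := by
  have e : (fun x => centredTail N x k - centredTail M x k) =
      -fun x => harmonicTail M x N - expSeq[fun x => harmonicTail M x N] := by
    funext x
    have h := Finset.sum_Ico_consecutive (fun i => (x i - 1) / ((i : ℝ) + 1)) hk hM
    have h2 := centredTail_eq hM x
    rw [Pi.neg_apply, integral_harmonicTail hM, ← h2]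
    simp only [centredTail]
    rw [← h]
    ring
  have hL : MemLp (fun x => harmonicTail M x N - expSeq[fun x => harmonicTail M x N]) 2 expSeq :=
    (memLp_harmonicTail M N).sub (memLp_const _)
  rw [e, eLpNorm_neg, hL.eLpNorm_eq_integral_rpow_norm (by norm_num) (by norm_num)]
  refine ENNReal.ofReal_le_ofReal ?_
  have hv := variance_harmonicTail M N
  rw [variance_eq_integral (X := fun x => harmonicTail M x N)
    ((measurable_pi_apply N).comp (measurable_harmonicTail M)).aemeasurable]
    at hv
  have e2 : ∀ x : ℕ → ℝ, ‖harmonicTail M x N - expSeq[fun x => harmonicTail M x N]‖ ^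
      (2 : ENNReal).toReal = (harmonicTail M x N - expSeq[fun x => harmonicTail M x N]) ^ 2 := by
    intro x
    simp
  simp only [e2]
  rw [hv, Real.sqrt_eq_rpow]
  have e3 : (2 : ENNReal).toReal⁻¹ = 1 / 2 := by norm_num
  rw [e3]
  exact Real.rpow_le_rpow (Finset.sum_nonneg fun j _ => by positivity)
    (sum_Ico_one_div_sq_le hN hM) (by norm_num)

/-- Fatou as `M → ∞`: the bound on the distance from `N` to `M` is uniform in `M` and passes to the
almost sure limit. -/
lemma tendsto_eLpNorm_centredTail_sub (k : ℕ) :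
    Tendsto (fun N => eLpNorm (fun x => centredTail N x k - centredSeries x k) 2 expSeq)
      atTop (𝓝 0) := by
  have h0 : Tendsto (fun N : ℕ => ENNReal.ofReal (Real.sqrt (1 / N))) atTop (𝓝 0) := by
    have h1 := (Real.continuous_sqrt.tendsto 0).comp tendsto_one_div_atTop_nhds_zero_nat
    rw [Real.sqrt_zero] at h1
    have h2 := ENNReal.tendsto_ofReal h1
    rw [ENNReal.ofReal_zero] at h2
    exact h2
  refine tendsto_of_tendsto_of_tendsto_of_le_of_le' tendsto_const_nhds h0
    (Eventually.of_forall fun _ => zero_le) ?_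
  filter_upwards [eventually_ge_atTop k, eventually_gt_atTop 0] with N hk hN
  have h := Lp.eLpNorm_lim_le_liminf_eLpNorm (μ := expSeq) (p := 2)
    (f := fun M x => centredTail N x k - centredTail M x k)
    (fun M => ((measurable_centredTail N k).sub (measurable_centredTail M k)).aestronglyMeasurable)
    (fun x => centredTail N x k - centredSeries x k) (by
      filter_upwards [ae_tendsto_centredTail] with x hx
      exact tendsto_const_nhds.sub (hx k))
  refine h.trans ?_
  refine liminf_le_of_frequently_le' (Eventually.frequently ?_)
  filter_upwards [eventually_ge_atTop N] with M hM
  exact eLpNorm_centredTail_sub hk hN hM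

lemma memLp_centredTail (N k : ℕ) : MemLp (fun x => centredTail N x k) 2 expSeq := by
  unfold centredTail
  exact memLp_finsetSum _ fun i _ => by
    simpa [div_eq_mul_inv] using
      ((memLp_eval_expSeq i).sub (memLp_const 1)).mul_const (((i : ℝ) + 1)⁻¹)

lemma measurable_centredSeries_apply (k : ℕ) : Measurable fun x => centredSeries x k :=
  (measurable_pi_apply k).comp measurable_centredSeries

lemma memLp_centredSeries (k : ℕ) : MemLp (fun x => centredSeries x k) 2 expSeq := by
  obtain ⟨N, hN⟩ := ((tendsto_eLpNorm_centredTail_sub k).eventually_lt_const one_pos).exists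
  have h : MemLp (fun x => centredTail N x k - centredSeries x k) 2 expSeq :=
    ⟨((measurable_centredTail N k).sub (measurable_centredSeries_apply k)).aestronglyMeasurable,
      hN.trans ENNReal.one_lt_top⟩
  refine ((memLp_centredTail N k).sub h).ae_eq (Eventually.of_forall fun x => ?_)
  simp

lemma integral_centredSeries (k : ℕ) : ∫ x, centredSeries x k ∂expSeq = 0 := by
  have h1 : Tendsto (fun N => eLpNorm ((fun x => centredTail N x k) - fun x => centredSeries x k) 1
      expSeq) atTop (𝓝 0) := by
    refine tendsto_of_tendsto_of_tendsto_of_le_of_le tendsto_const_nhds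
      (tendsto_eLpNorm_centredTail_sub k) (fun _ => zero_le) fun N => ?_
    exact eLpNorm_le_eLpNorm_of_exponent_le one_le_two
      ((measurable_centredTail N k).sub (measurable_centredSeries_apply k)).aestronglyMeasurable
  have h := tendsto_integral_of_L1' (fun x => centredSeries x k)
    (measurable_centredSeries_apply k).aestronglyMeasurable
    (Eventually.of_forall fun N => (memLp_centredTail N k).integrable one_le_two) h1
  refine tendsto_nhds_unique h (tendsto_const_nhds.congr' ?_)
  filter_upwards [eventually_ge_atTop k] with N hN
  simp only [centredTail_eq hN]
  rw [integral_sub (integrable_harmonicTail N k) (integrable_const _), integral_harmonicTail hN]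
  simp

lemma integrable_negLogSum (k : ℕ) : Integrable (fun x => negLogSum x k) expSeq := by
  have h := (identDistrib_centredSeries.comp (measurable_pi_apply k)).integrable_snd
    ((memLp_centredSeries k).integrable one_le_two)
  refine ((h.sub (integrable_const (harmonic k : ℝ))).add
    (integrable_const Real.eulerMascheroniConstant)).congr (Eventually.of_forall fun x => ?_)
  simp

/-- Equality in law with the centred series, whose mean is `0` as an `L¹` limit of centred sums. -/
lemma integral_negLogSum (k : ℕ) :
    ∫ x, negLogSum x k ∂expSeq = Real.eulerMascheroniConstant - (harmonic k : ℝ) := by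
  have h := (identDistrib_centredSeries.comp (measurable_pi_apply k)).integral_eq
  simp only [Function.comp_def, integral_centredSeries] at h
  have h1 : Integrable (fun x => negLogSum x k - Real.eulerMascheroniConstant) expSeq :=
    (integrable_negLogSum k).sub (integrable_const _)
  rw [integral_add h1 (integrable_const _),
    integral_sub (integrable_negLogSum k) (integrable_const _)] at h
  simp at h
  linarith

/-! ### Conditional laws and limits in distribution under equality in law. -/

/-- Independence makes the joint law of `(X, U)` a product, so by Fubini the value of `X` may be
frozen. -/
lemma hasCondDistrib_of_indepFun {Ω E F G : Type*} [MeasurableSpace Ω] [MeasurableSpace E]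
    [MeasurableSpace F] [MeasurableSpace G] {P : Measure Ω} [IsProbabilityMeasure P]
    {X : Ω → E} {U : Ω → F} {ν : Measure F} [IsProbabilityMeasure ν] (hX : Measurable X)
    (hU : HasLaw U ν P) (hind : IndepFun X U P) {f : E × F → G} (hf : Measurable f)
    (κ : Kernel E G) [IsMarkovKernel κ] (hκ : ∀ x, κ x = ν.map fun u => f (x, u)) :
    HasCondDistrib (fun ω => f (X ω, U ω)) X κ P := by
  have hUm := hU.aemeasurable
  have hpair : P.map (fun ω => (X ω, U ω)) = (P.map X).prod ν := by
    have := (indepFun_iff_map_prod_eq_prod_map_map hX.aemeasurable hUm).1 hind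
    rw [this, hU.map_eq]
  have hPX : IsProbabilityMeasure (P.map X) := Measure.isProbabilityMeasure_map hX.aemeasurable
  have hg : Measurable fun p : E × F => (p.1, f p) := measurable_fst.prodMk hf
  refine ⟨(hX.aemeasurable).prodMk (hf.comp_aemeasurable (hX.aemeasurable.prodMk hUm)), ?_⟩
  ext s hs
  have e : P.map (fun ω => (X ω, f (X ω, U ω))) = ((P.map X).prod ν).map fun p => (p.1, f p) := by
    rw [← hpair, AEMeasurable.map_map_of_aemeasurable hg.aemeasurable (hX.aemeasurable.prodMk hUm)]
    rfl
  rw [e, Measure.map_apply hg hs, Measure.prod_apply (hg hs), Measure.compProd_apply hs]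
  refine lintegral_congr fun x => ?_
  have hfx : Measurable fun u => f (x, u) := hf.comp measurable_prodMk_left
  rw [hκ, Measure.map_apply hfx (measurable_prodMk_left hs)]
  rfl

lemma hasCondDistrib_of_identDistrib {Ω Ω' E F : Type*} [MeasurableSpace Ω] [MeasurableSpace Ω']
    [MeasurableSpace E] [MeasurableSpace F] {P : Measure Ω} {P' : Measure Ω'}
    {X : Ω → E} {Y : Ω → F} {X' : Ω' → E} {Y' : Ω' → F} {κ : Kernel E F}
    (h : HasCondDistrib Y X κ P)
    (hid : IdentDistrib (fun ω => (X ω, Y ω)) (fun ω => (X' ω, Y' ω)) P P') :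
    HasCondDistrib Y' X' κ P' := by
  have h1 : P.map X = P'.map X' := (hid.comp measurable_fst).map_eq
  refine ⟨hid.aemeasurable_snd, ?_⟩
  rw [← hid.map_eq, h.map_eq, h1]

lemma tendstoInDistribution_congr_identDistrib {ι Ω Ω' Ω₀ E : Type*} [MeasurableSpace Ω]
    [MeasurableSpace Ω'] [MeasurableSpace Ω₀] [MeasurableSpace E] [TopologicalSpace E]
    [OpensMeasurableSpace E] {μ : Measure Ω} [IsProbabilityMeasure μ] {ν : Measure Ω'} [IsProbabilityMeasure ν]
    {μ₀ : Measure Ω₀} [IsProbabilityMeasure μ₀]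
    {X : ι → Ω → E} {Y : ι → Ω' → E} {Z : Ω₀ → E} {l : Filter ι}
    (h : TendstoInDistribution X l Z (fun _ => μ) μ₀) (hXY : ∀ i, IdentDistrib (X i) (Y i) μ ν)
    {Ω'' : Type*} [MeasurableSpace Ω''] {ρ : Measure Ω''} [IsProbabilityMeasure ρ] {W : Ω'' → E}
    (hZ : IdentDistrib Z W μ₀ ρ) :
    TendstoInDistribution Y l W (fun _ => ν) ρ where
  forall_aemeasurable i := (hXY i).aemeasurable_snd
  aemeasurable_limit := hZ.aemeasurable_snd
  tendsto := by
    have h1 := h.tendsto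
    have e1 : (⟨μ₀.map Z, Measure.isProbabilityMeasure_map h.aemeasurable_limit⟩ :
        ProbabilityMeasure E) =
        ⟨ρ.map W, Measure.isProbabilityMeasure_map hZ.aemeasurable_snd⟩ := Subtype.ext hZ.map_eq
    rw [e1] at h1
    refine h1.congr fun i => Subtype.ext (hXY i).map_eq

/-! ### The Gumbel law and the transition kernel. -/

lemma hasLaw_negLogSum (k : ℕ) :
    HasLaw (fun x => negLogSum x k) ((gammaMeasure ((k : ℝ) + 1) 1).map fun x => -Real.log x)
      expSeq := by
  have hm : Measurable fun x : ℝ => -Real.log x := by fun_prop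
  exact HasLaw.fun_comp (Y := fun x : ℝ => -Real.log x) ⟨hm.aemeasurable, rfl⟩ (hasLaw_sum_expSeq k)

lemma expMeasure_Ici {c : ℝ} (hc : 0 ≤ c) :
    expMeasure 1 (Set.Ici c) = ENNReal.ofReal (Real.exp (-c)) := by
  have hac : expMeasure 1 ≪ volume := withDensity_absolutelyContinuous _ _
  have h1 : expMeasure 1 (Set.Ici c) = expMeasure 1 (Set.Ioi c) :=
    measure_congr (hac.ae_eq Ioi_ae_eq_Ici).symm
  have h2 : expMeasure 1 (Set.Iic c) = ENNReal.ofReal (1 - Real.exp (-c)) := by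
    rw [← ofReal_cdf, cdf_expMeasure_eq one_pos, if_pos hc, one_mul]
  rw [h1, ← Set.compl_Iic, prob_compl_eq_one_sub measurableSet_Iic, h2, ← ENNReal.ofReal_one,
    ← ENNReal.ofReal_sub _ (sub_nonneg.2 (Real.exp_le_one_iff.2 (neg_nonpos.2 hc)))]
  congr 1
  ring

/-- The law of `-log (exp (-y) + t)` for `t` of law `Exp(1)`, as a kernel in `y`. -/
noncomputable def logShiftKernel : Kernel ℝ ℝ :=
  (Kernel.id ×ₖ Kernel.const ℝ (expMeasure 1)).map
    fun p : ℝ × ℝ => -Real.log (Real.exp (-p.1) + p.2)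

lemma measurable_logShift :
    Measurable fun p : ℝ × ℝ => -Real.log (Real.exp (-p.1) + p.2) := by fun_prop

instance : IsMarkovKernel logShiftKernel := by
  unfold logShiftKernel
  exact Kernel.IsMarkovKernel.map _ measurable_logShift

lemma logShiftKernel_apply (y : ℝ) :
    logShiftKernel y = (expMeasure 1).map fun t => -Real.log (Real.exp (-y) + t) := by
  rw [logShiftKernel, Kernel.map_apply _ measurable_logShift, Kernel.prod_apply, Kernel.id_apply,
    Kernel.const_apply, Measure.dirac_prod,
    Measure.map_map measurable_logShift measurable_prodMk_left]
  rfl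

/-- Monotonicity of `log` on the positive axis. Taking `b = 0` gives the Gumbel law, and `b = exp
(-y)` the transition law from `y`. -/
lemma expMeasure_neg_log_add_le {b : ℝ} (hb : 0 ≤ b) (x : ℝ) :
    expMeasure 1 {t | -Real.log (b + t) ≤ x} =
      expMeasure 1 (Set.Ici (Real.exp (-x) - b)) := by
  refine measure_congr (eventuallyEq_set.2 ?_)
  filter_upwards [ae_pos_expMeasure] with t ht
  have hpos : 0 < b + t := by linarith
  simp only [Set.mem_Ici]
  rw [neg_le, Real.le_log_iff_exp_le hpos, sub_le_iff_le_add, add_comm t]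

lemma logShiftKernel_Iic {x y : ℝ} (hxy : x ≤ y) :
    logShiftKernel y (Set.Iic x) = ENNReal.ofReal (Real.exp (Real.exp (-y) - Real.exp (-x))) := by
  have hm : Measurable fun t : ℝ => -Real.log (Real.exp (-y) + t) := by fun_prop
  rw [logShiftKernel_apply, Measure.map_apply hm measurableSet_Iic]
  change expMeasure 1 {t | -Real.log (Real.exp (-y) + t) ≤ x} = _
  rw [expMeasure_neg_log_add_le (Real.exp_pos _).le, expMeasure_Ici, neg_sub]
  exact sub_nonneg.2 (Real.exp_le_exp.2 (neg_le_neg hxy))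

lemma map_neg_log_expMeasure_Iic (x : ℝ) :
    (expMeasure 1).map (fun t => -Real.log t) (Set.Iic x) =
      ENNReal.ofReal (Real.exp (-Real.exp (-x))) := by
  have hm : Measurable fun t : ℝ => -Real.log t := by fun_prop
  rw [Measure.map_apply hm measurableSet_Iic]
  have h := expMeasure_neg_log_add_le le_rfl x
  simp only [zero_add, sub_zero] at h
  rw [← expMeasure_Ici (Real.exp_pos _).le, ← h]
  rfl

/-- The transition law is the Gumbel distribution conditioned on being at most `y`. -/
lemma logShiftKernel_eq_cond (y : ℝ) :
    logShiftKernel y = ProbabilityTheory.cond ((expMeasure 1).map fun t => -Real.log t)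
      (Set.Iic y) := by
  set g := (expMeasure 1).map fun t => -Real.log t with hg
  have hm : Measurable fun t : ℝ => -Real.log t := by fun_prop
  have hgp : IsProbabilityMeasure g := Measure.isProbabilityMeasure_map hm.aemeasurable
  have hpos : g (Set.Iic y) ≠ 0 := by
    rw [hg, map_neg_log_expMeasure_Iic]
    simp [Real.exp_pos]
  have := cond_isProbabilityMeasure hpos
  refine Measure.ext_of_Iic _ _ fun x => ?_
  rw [cond_apply measurableSet_Iic, Set.Iic_inter_Iic]
  -- Below `y` the conditional distribution function is a quotient of Gumbel ones; above `y` both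
  -- sides are `1`.
  rcases le_total x y with hxy | hxy
  · rw [min_eq_right hxy, logShiftKernel_Iic hxy, hg, map_neg_log_expMeasure_Iic,
      map_neg_log_expMeasure_Iic, ← ENNReal.ofReal_inv_of_pos (Real.exp_pos _),
      ← ENNReal.ofReal_mul (by positivity), ← Real.exp_neg, ← Real.exp_add]
    congr 2
    ring
  · rw [min_eq_left hxy, ENNReal.inv_mul_cancel hpos (measure_ne_top _ _)]
    refine le_antisymm prob_le_one ?_
    have h1 : logShiftKernel y (Set.Iic y) = 1 := by
      rw [logShiftKernel_Iic le_rfl, sub_self, Real.exp_zero, ENNReal.ofReal_one]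
    rw [← h1]
    exact measure_mono (Set.Iic_subset_Iic.2 hxy)

lemma ae_exp_neg_negLogSum :
    ∀ᵐ x ∂expSeq, ∀ k, Real.exp (-negLogSum x k) = ∑ i ∈ Finset.range (k + 1), x i := by
  filter_upwards [ae_pos_expSeq] with x hx k
  rw [negLogSum, neg_neg, Real.exp_log (Finset.sum_pos (fun i _ => hx i) ⟨0, by simp⟩)]

/-- The history is a function of `x 0, …, x k`, and the next partial sum adds the independent `x (k
+ 1)` to `exp (-negLogSum x k)`. -/
lemma hasCondDistrib_negLogSum (k : ℕ) :
    HasCondDistrib (fun x => negLogSum x (k + 1)) (fun x => fun i : Fin (k + 1) => negLogSum x i)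
      (logShiftKernel.comap (fun h : Fin (k + 1) → ℝ => h (Fin.last k)) (measurable_pi_apply _))
      expSeq := by
  have hX : Measurable fun x => fun i : Fin (k + 1) => negLogSum x i :=
    measurable_pi_lambda _ fun i => (measurable_pi_apply _).comp measurable_negLogSum
  have hind := indepFun_eval_expSeq (n := k + 1) hX (by
    intro x
    funext i
    simp only [negLogSum]
    congr 2
    refine Finset.sum_congr rfl fun j hj => if_pos ?_
    have := i.2
    have := Finset.mem_range.1 hj
    omega)
  have h := hasCondDistrib_of_indepFun hX (hasLaw_eval_expSeq (k + 1)) hind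
    (f := fun p : (Fin (k + 1) → ℝ) × ℝ => -Real.log (Real.exp (-p.1 (Fin.last k)) + p.2))
    (by fun_prop)
    (logShiftKernel.comap (fun h : Fin (k + 1) → ℝ => h (Fin.last k)) (measurable_pi_apply _))
    (fun x => by rw [Kernel.comap_apply, logShiftKernel_apply])
  refine HasLaw.congr h ?_
  filter_upwards [ae_exp_neg_negLogSum] with x hx
  have h1 := hx k
  simp only [Fin.val_last, h1, ← Finset.sum_range_succ]
  rfl

/-! ### Transfer to the order statistics, and the theorem. -/

lemma identDistrib_kthLargest {Ω : Type*} [MeasurableSpace Ω] {P : Measure Ω} {X : Ω → ℕ → ℝ}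
    (hX : HasLaw X expSeq P) (n : ℕ) :
    IdentDistrib (fun ω k => kthLargest n k (X ω)) (harmonicTail n) P expSeq where
  aemeasurable_fst := (measurable_kthLargest n).comp_aemeasurable hX.aemeasurable
  aemeasurable_snd := (measurable_harmonicTail n).aemeasurable
  map_eq := by
    rw [← map_kthLargest_expSeq, ← hX.map_eq, AEMeasurable.map_map_of_aemeasurable
      (measurable_kthLargest n).aemeasurable hX.aemeasurable]
    rfl

lemma identDistrib_kthLargest_apply {Ω : Type*} [MeasurableSpace Ω] {P : Measure Ω}
    {X : Ω → ℕ → ℝ} (hX : HasLaw X expSeq P) (n k : ℕ) :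
    IdentDistrib (fun ω => kthLargest n k (X ω)) (fun x => harmonicTail n x k) P expSeq :=
  (identDistrib_kthLargest hX n).comp (measurable_pi_apply k)

/-- Joint convergence in distribution of the recentred order statistics. -/
lemma tendstoInDistribution_kthLargest_sub_log {Ω : Type*} [MeasurableSpace Ω] {P : Measure Ω}
    [IsProbabilityMeasure P] {X : Ω → ℕ → ℝ} (hX : HasLaw X expSeq P) :
    TendstoInDistribution (fun (n : ℕ) ω => fun k : ℕ => kthLargest n k (X ω) - Real.log n) atTop
      negLogSum (fun _ => P) expSeq := by
  have hsub : ∀ n : ℕ, Measurable fun (y : ℕ → ℝ) (k : ℕ) => y k - Real.log n := fun n => by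
    fun_prop
  -- The coupling: for each `n` this variable has the law of the recentred order statistics, and all
  -- of them converge almost surely on one space.
  have h : TendstoInDistribution
      (fun (n : ℕ) x => fun k : ℕ => harmonicTail n (logIncr x) k - Real.log n) atTop
      negLogSum (fun _ => expSeq) expSeq := by
    refine tendstoInDistribution_of_ae_tendsto (fun n => ?_) measurable_negLogSum.aemeasurable ?_
    · exact ((hsub n).comp ((measurable_harmonicTail n).comp measurable_logIncr)).aemeasurable
    · filter_upwards [ae_tendsto_harmonicTail_logIncr] with x hx
      exact tendsto_pi_nhds.2 hx
  refine tendstoInDistribution_congr_identDistrib h (fun n => ?_)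
    (IdentDistrib.refl measurable_negLogSum.aemeasurable)
  have h1 : IdentDistrib (fun x => harmonicTail n (logIncr x)) (harmonicTail n) expSeq expSeq :=
    ⟨((measurable_harmonicTail n).comp measurable_logIncr).aemeasurable,
      (measurable_harmonicTail n).aemeasurable, by
        conv_rhs => rw [← map_logIncr_expSeq,
          Measure.map_map (measurable_harmonicTail n) measurable_logIncr]
        rfl⟩
  exact (h1.trans (identDistrib_kthLargest hX n).symm).comp (hsub n)

/-- Sequences are indexed from `0`: `T i`, `kthLargest n k` and `W k` below are
`T_{i+1}`, `M_n^{(m)}` and `W^{(m)}` with `m = k + 1`. -/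
theorem mainTheorem4 {Ω : Type*} [MeasurableSpace Ω] (P : Measure Ω) [IsProbabilityMeasure P]
    (T : ℕ → Ω → ℝ) (hindep : iIndepFun T P) (hlaw : ∀ i, HasLaw (T i) (expMeasure 1) P) :
    -- the moment generating function and the mean of `M_n^{(m)}`, `1 ≤ m ≤ n`
    (∀ n k : ℕ, k < n →
      (∀ s : ℂ, s.re < (k : ℝ) + 1 →
        Integrable (fun ω => Complex.exp (s * (kthLargest n k (fun i => T i ω) : ℝ))) P ∧
        ∫ ω, Complex.exp (s * (kthLargest n k (fun i => T i ω) : ℝ)) ∂P =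
          Complex.Gamma ((n : ℂ) + 1) * Complex.Gamma ((k : ℂ) + 1 - s) /
            (Complex.Gamma ((k : ℂ) + 1) * Complex.Gamma ((n : ℂ) + 1 - s))) ∧
      Integrable (fun ω => kthLargest n k (fun i => T i ω)) P ∧
      ∫ ω, kthLargest n k (fun i => T i ω) ∂P = (harmonic n : ℝ) - (harmonic k : ℝ)) ∧
    -- `(M_n^{(m)} - log n)_{m ≥ 1}` has a joint limit in distribution
    (∃ (Q : Measure (ℕ → ℝ)) (_ : IsProbabilityMeasure Q),
      TendstoInDistribution (fun (n : ℕ) ω => fun k : ℕ =>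
        kthLargest n k (fun i => T i ω) - Real.log n) atTop (fun w => w) (fun _ => P) Q) ∧
    -- the series `∑_{j ≥ m} (T_j - 1) / j` converge in `L²` and almost surely, to `S k`, and
    ∃ S : ℕ → Ω → ℝ,
      (∀ k : ℕ, MemLp (S k) 2 P ∧
        Tendsto (fun N : ℕ => eLpNorm
          (fun ω => (∑ i ∈ Finset.Ico k N, (T i ω - 1) / ((i : ℝ) + 1)) - S k ω) 2 P)
          atTop (𝓝 0) ∧
        ∀ᵐ ω ∂P, Tendsto (fun N : ℕ => ∑ i ∈ Finset.Ico k N, (T i ω - 1) / ((i : ℝ) + 1))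
          atTop (𝓝 (S k ω))) ∧
      -- for every sequence `W` that is the joint limit in distribution:
      ∀ {Ω' : Type*} [MeasurableSpace Ω'] (P' : Measure Ω') [IsProbabilityMeasure P']
        (W : ℕ → Ω' → ℝ),
        TendstoInDistribution (fun (n : ℕ) ω => fun k : ℕ =>
          kthLargest n k (fun i => T i ω) - Real.log n) atTop (fun ω' => fun k => W k ω')
          (fun _ => P) P' →
        (∀ k : ℕ,
          -- convergence in distribution for each single `m`
          TendstoInDistribution (fun (n : ℕ) ω =>
            kthLargest n k (fun i => T i ω) - Real.log n) atTop (W k) (fun _ => P) P' ∧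
          -- `W^{(m)}` is distributed as `-log Γ_m`
          HasLaw (W k) ((gammaMeasure ((k : ℝ) + 1) 1).map (fun x => -Real.log x)) P' ∧
          -- the moment generating function of `W^{(m)}`
          (∀ s : ℂ, s.re < (k : ℝ) + 1 →
            Integrable (fun ω => Complex.exp (s * (W k ω : ℝ))) P' ∧
            ∫ ω, Complex.exp (s * (W k ω : ℝ)) ∂P' =
              Complex.Gamma ((k : ℂ) + 1 - s) / Complex.Gamma ((k : ℂ) + 1)) ∧
          -- the mean of `W^{(m)}`
          Integrable (W k) P' ∧
          Tendsto (fun n : ℕ => ∫ ω, (kthLargest n k (fun i => T i ω) - Real.log n) ∂P)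
            atTop (𝓝 (∫ ω, W k ω ∂P')) ∧
          Tendsto (fun n : ℕ => (harmonic n : ℝ) - (harmonic k : ℝ) - Real.log n)
            atTop (𝓝 (∫ ω, W k ω ∂P')) ∧
          ∫ ω, W k ω ∂P' = Real.eulerMascheroniConstant - (harmonic k : ℝ)) ∧
        -- the series represent the centred limits, jointly for all `m`
        IdentDistrib (fun ω => fun k : ℕ => S k ω)
          (fun ω' => fun k : ℕ => W k ω' - ∫ ω, W k ω ∂P') P P' ∧
        IdentDistrib (fun ω => fun k : ℕ => S k ω)
          (fun ω' => fun k : ℕ =>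
            W k ω' - Real.eulerMascheroniConstant + (harmonic k : ℝ)) P P' ∧
        -- `W^{(1)}` has the Gumbel distribution
        (∀ x : ℝ, (P'.map (W 0)) (Set.Iic x) = ENNReal.ofReal (Real.exp (-Real.exp (-x)))) ∧
        -- `W^{(1)}, W^{(2)}, …` is a homogeneous Markov chain; the transition law from `y` is
        -- the Gumbel distribution conditioned on being at most `y`
        (∃ κ : Kernel ℝ ℝ, IsHomogeneousMarkovChain W κ P' ∧
          (∀ k : ℕ, HasCondDistrib (W (k + 1)) (W k) κ P') ∧
          (∀ y : ℝ, κ y = ProbabilityTheory.cond (P'.map (W 0)) (Set.Iic y)) ∧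
          (∀ x y : ℝ, x ≤ y →
            κ y (Set.Iic x) = ENNReal.ofReal (Real.exp (Real.exp (-y) - Real.exp (-x))))) ∧
        -- `(e^{-W^{(1)}}, e^{-W^{(2)}}, …)` is distributed as `(T_1, T_1 + T_2, …)`
        IdentDistrib (fun ω' => fun k : ℕ => Real.exp (-(W k ω')))
          (fun ω => fun k : ℕ => ∑ i ∈ Finset.range (k + 1), T i ω) P' P := by
  have hT : HasLaw (fun ω i => T i ω) expSeq P :=
    hindep.hasLaw_infinitePi hlaw (aemeasurable_pi_lambda _ fun i => (hlaw i).aemeasurable)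
  have hTid : IdentDistrib (fun ω i => T i ω) (fun x => x) P expSeq :=
    hT.identDistrib HasLaw.id
  have hconv := tendstoInDistribution_kthLargest_sub_log hT
  have hmean : ∀ n k : ℕ, k ≤ n → Integrable (fun ω => kthLargest n k (fun i => T i ω)) P ∧
      ∫ ω, kthLargest n k (fun i => T i ω) ∂P = (harmonic n : ℝ) - (harmonic k : ℝ) := by
    intro n k hk
    have hid := identDistrib_kthLargest_apply hT n k
    exact ⟨hid.symm.integrable_snd (integrable_harmonicTail n k),
      hid.integral_eq.trans (integral_harmonicTail hk)⟩
  have hexp : ∀ s : ℂ, Measurable fun y : ℝ => Complex.exp (s * y) := fun s => by fun_prop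
  have hQ : IsProbabilityMeasure (expSeq.map negLogSum) :=
    Measure.isProbabilityMeasure_map measurable_negLogSum.aemeasurable
  refine ⟨fun n k hk => ⟨fun s hs => ?_, hmean n k hk.le⟩, ⟨expSeq.map negLogSum, hQ, ?_⟩,
    fun k ω => centredSeries (fun i => T i ω) k, fun k => ⟨?_, ?_, ?_⟩, ?_⟩
  · have hid := (identDistrib_kthLargest_apply hT n k).comp (hexp s)
    refine ⟨hid.symm.integrable_snd (integrable_exp_mul_harmonicTail hs n), ?_⟩
    exact hid.integral_eq.trans
      ((integral_exp_mul_harmonicTail hs).trans (prod_Ico_div_sub_eq_Gamma hs hk.le))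
  · have hZ : IdentDistrib negLogSum (fun w => w) expSeq (expSeq.map negLogSum) :=
      ⟨measurable_negLogSum.aemeasurable, aemeasurable_id', Measure.map_id.symm⟩
    exact tendstoInDistribution_congr_identDistrib hconv
      (fun n => IdentDistrib.refl (hconv.forall_aemeasurable n)) hZ
  · exact (hTid.comp (measurable_centredSeries_apply k)).symm.memLp_snd (memLp_centredSeries k)
  · refine (tendsto_eLpNorm_centredTail_sub k).congr fun N => ?_
    exact ((hTid.comp ((measurable_centredTail N k).sub
      (measurable_centredSeries_apply k))).eLpNorm_eq 2).symm
  · have h := ae_tendsto_centredTail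
    rw [← hT.map_eq] at h
    filter_upwards [ae_of_ae_map hT.aemeasurable h] with ω hω
    exact hω k
  intro Ω' _ P' _ W hW
  -- Limits in distribution are unique in law, so every claim about `W` reduces to one about
  -- `negLogSum`.
  have hlim : IdentDistrib (fun ω' => fun k => W k ω') negLogSum P' expSeq :=
    ⟨hW.aemeasurable_limit, measurable_negLogSum.aemeasurable,
      tendstoInDistribution_unique _ hW hconv⟩
  have hlimk : ∀ k, IdentDistrib (W k) (fun x => negLogSum x k) P' expSeq := fun k =>
    hlim.comp (measurable_pi_apply k)
  have hintW : ∀ k, ∫ ω, W k ω ∂P' = Real.eulerMascheroniConstant - (harmonic k : ℝ) := fun k =>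
    (hlimk k).integral_eq.trans (integral_negLogSum k)
  have hharm : ∀ k : ℕ, Tendsto (fun n : ℕ => (harmonic n : ℝ) - (harmonic k : ℝ) - Real.log n)
      atTop (𝓝 (∫ ω, W k ω ∂P')) := by
    intro k
    rw [hintW]
    refine (Real.tendsto_harmonic_sub_log.sub_const (harmonic k : ℝ)).congr fun n => ?_
    ring
  have hcentre : IdentDistrib (fun ω => fun k : ℕ => centredSeries (fun i => T i ω) k)
      (fun ω' => fun k : ℕ => W k ω' - Real.eulerMascheroniConstant + (harmonic k : ℝ)) P P' := by
    have hm : Measurable fun (y : ℕ → ℝ) (k : ℕ) =>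
        y k - Real.eulerMascheroniConstant + (harmonic k : ℝ) := by fun_prop
    exact ((hTid.comp measurable_centredSeries).trans identDistrib_centredSeries).trans
      (hlim.comp hm).symm
  have hW0 : P'.map (W 0) = (expMeasure 1).map fun t => -Real.log t := by
    rw [(hlimk 0).map_eq, (hasLaw_negLogSum 0).map_eq, expMeasure]
    simp
  have hcond : ∀ k : ℕ, HasCondDistrib (W (k + 1)) (fun ω => fun i : Fin (k + 1) => W i ω)
      (logShiftKernel.comap (fun h : Fin (k + 1) → ℝ => h (Fin.last k)) (measurable_pi_apply _))
      P' := by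
    intro k
    refine hasCondDistrib_of_identDistrib (hasCondDistrib_negLogSum k) ?_
    have hm : Measurable fun y : ℕ → ℝ => ((fun i : Fin (k + 1) => y i), y (k + 1)) := by fun_prop
    exact hlim.symm.comp hm
  refine ⟨fun k => ⟨?_, (hlimk k).symm.hasLaw (hasLaw_negLogSum k), fun s hs => ?_,
    (hlimk k).symm.integrable_snd (integrable_negLogSum k), ?_, hharm k, hintW k⟩, ?_, hcentre,
    fun x => ?_, ⟨logShiftKernel, ⟨inferInstance, hcond⟩, fun k => ?_, fun y => ?_,
    fun x y hxy => logShiftKernel_Iic hxy⟩, ?_⟩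
  · exact hW.continuous_comp (continuous_apply k)
  · have hs' : s.re < ((k : ℝ) + 1) := hs
    have hpos : (0 : ℝ) < (k : ℝ) + 1 := by positivity
    have hm : Measurable fun x : ℝ => Complex.exp (s * (-Real.log x : ℝ)) := by fun_prop
    have hid : IdentDistrib (fun ω => Complex.exp (s * (W k ω : ℝ)))
        (fun x : ℝ => Complex.exp (s * (-Real.log x : ℝ))) P' (gammaMeasure ((k : ℝ) + 1) 1) :=
      ((hlimk k).comp (hexp s)).trans (((hasLaw_sum_expSeq k).identDistrib HasLaw.id).comp hm)
    refine ⟨hid.symm.integrable_snd (integrable_exp_neg_log_gammaMeasure hpos hs), ?_⟩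
    rw [hid.integral_eq, integral_exp_neg_log_gammaMeasure hpos hs]
    push_cast
    rfl
  -- The formula for the mean is available only for `k ≤ n`, since `kthLargest` is `0` by convention
  -- for smaller `n`.
  · refine (hharm k).congr' ?_
    filter_upwards [eventually_ge_atTop k] with n hn
    rw [integral_sub (hmean n k hn).1 (integrable_const _), (hmean n k hn).2]
    simp
  · convert hcentre using 4 with ω' k
    rw [hintW]
    ring
  · rw [hW0, map_neg_log_expMeasure_Iic]
  -- The kernel given the whole history factors through its last coordinate, so it is also the
  -- kernel given the present state.
  · exact HasCondDistrib.comp_right (f := fun h : Fin (k + 1) → ℝ => h (Fin.last k)) (hcond k)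
  · rw [hW0, logShiftKernel_eq_cond]
  · have hm : Measurable fun (y : ℕ → ℝ) (k : ℕ) => Real.exp (-(y k)) := by fun_prop
    have hm' : Measurable fun (x : ℕ → ℝ) (k : ℕ) => ∑ i ∈ Finset.range (k + 1), x i := by
      fun_prop
    have hae : IdentDistrib (fun x k => Real.exp (-negLogSum x k))
        (fun (x : ℕ → ℝ) (k : ℕ) => ∑ i ∈ Finset.range (k + 1), x i) expSeq expSeq := by
      refine IdentDistrib.of_ae_eq (hm.comp measurable_negLogSum).aemeasurable ?_
      filter_upwards [ae_exp_neg_negLogSum] with x hx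
      exact funext hx
    exact ((hlim.comp hm).trans hae).trans (hTid.comp hm').symm
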